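/- Let $M$ be a smooth (Hausdorff, second countable, finite-dimensional) manifold and let $\pi:A\to M$ be a smooth affine bundle of rank $n>0$: a locally trivial smooth bundle whose fibres $A_x$ are affine spaces and whose local trivializations are affine on the fibres. An affine function on $A$ is a smooth function $a:A\to\mathbb R$ whose restriction to each fibre is affine. Let $A^+\to M$ be the vector bundle of rank $n+1$ with fibres $A^+_x=\mathrm{Aff}(A_x,\mathbb R)$; its sections $\tilde a\in\Gamma(A^+)$ are identified with the affine functions $a$ on $A$, and $\tilde 1\in\Gamma(A^+)$ is the section corresponding to the constant function $1$. A Jacobi structure on $A$ is a pair $(\Lambda,E)$ of a bivector field and a vector field on $A$ with $[\Lambda,\Lambda]_{SN}=-2E\wedge\Lambda$ and $[E,\Lambda]_{SN}=0$, where $[\cdot,\cdot]_{SN}$ is the Schouten bracket, with the sign convention for which $[X\wedge Y,X\wedge Y]_{SN}=2\,X\wedge Y\wedge[X,Y]$. Its Jacobi bracket is $\{f,g\}=\Lambda(df,dg)+fE(g)-gE(f)$ and the hamiltonian vector field of $f$ is $X_f=\#_\Lambda(df)+fE$, where $\beta(\#_\Lambda(\alpha))=\Lambda(\alpha,\beta)$.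 It is affine if $\{a,b\}$ is affine for all affine functions $a,b$, and strongly-affine if it is affine and $X_a(b)$ is an affine function for all affine functions $a,b$. A Lie algebroid structure on $A^+$ is a pair consisting of a real Lie algebra bracket $[\![\cdot,\cdot]\!]$ on $\Gamma(A^+)$ and a vector bundle morphism $\rho:A^+\to TM$ with $[\![X,fY]\!]=f[\![X,Y]\!]+\rho(X)(f)Y$ for all $X,Y\in\Gamma(A^+)$ and $f\in C^\infty(M)$. It is almost-special if the $C^\infty(M)$-submodule of $\Gamma(A^+)$ generated by $\tilde 1$ is an ideal of the Lie algebra $\Gamma(A^+)$. Then there is a one-to-one correspondence between the strongly-affine Jacobi structures on $A$ and the almost-special Lie algebroid structures on $A^+$: there is a bijection under which $(\Lambda,E)$ corresponds to $([\![\cdot,\cdot]\!],\rho)$ if and only if $$[\![\tilde a,\tilde b]\!]=\widetilde{\{a,b\}}\quad\text{for all affine functions } a,b \text{ on } A,$$ and in this case the anchor is given by $\rho(\tilde a)(f)\circ\pi=\{a,f\circ\pi\}-(f\circ\pi)\{a,1\}$ for all affine functions $a$ and all $f\in C^\infty(M)$. -/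

import Mathlib

open Bundle Set
open scoped Manifold ContDiff Topology

noncomputable section

/-! ## Jacobi structures on a manifold -/

section Jacobi

variable {E : Type*} [NormedAddCommGroup E] [NormedSpace ℝ E] [FiniteDimensional ℝ E]
  {H : Type*} [TopologicalSpace H] (I : ModelWithCorners ℝ E H)
  (N : Type*) [TopologicalSpace N] [ChartedSpace H N]

/-- A `2`-vector (bivector field) on a manifold: at each point `p` an alternating bilinear form
on the cotangent space `T_p^*N`, depending smoothly on `p`, i.e. `Λ(df, dg)` is a smooth function
for all smooth functions `f`, `g`. -/
structure BivectorField where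
  toFun : ∀ p : N, LinearMap.BilinForm ℝ (Module.Dual ℝ (TangentSpace I p))
  alternating : ∀ (p : N) (α : Module.Dual ℝ (TangentSpace I p)), toFun p α α = 0
  smooth : ∀ f g : N → ℝ, ContMDiff I 𝓘(ℝ, ℝ) ∞ f → ContMDiff I 𝓘(ℝ, ℝ) ∞ g →
    ContMDiff I 𝓘(ℝ, ℝ) ∞ (fun p => toFun p (mvfderiv I f p) (mvfderiv I g p))

variable {I N}

/-- The derivative `X(f)` of a function along a (not necessarily smooth) vector field. -/
def dirDeriv (X : ∀ p : N, TangentSpace I p) (f : N → ℝ) : N → ℝ :=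
  fun p => mvfderiv I f p (X p)

namespace BivectorField

/-- The function `Λ(df, dg)`. -/
def apply (Λ : BivectorField I N) (f g : N → ℝ) : N → ℝ :=
  fun p => Λ.toFun p (mvfderiv I f p) (mvfderiv I g p)

/-- The map `#_Λ : T_p^*N → T_pN`, characterized by `β(#_Λ(α)) = Λ(α, β)`. -/
def sharp (Λ : BivectorField I N) (p : N) (α : Module.Dual ℝ (TangentSpace I p)) :
    TangentSpace I p :=
  haveI : FiniteDimensional ℝ (TangentSpace I p) := inferInstanceAs (FiniteDimensional ℝ E)
  (Module.evalEquiv ℝ (TangentSpace I p)).symm (Λ.toFun p α)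

/-- The Schouten bracket `[Λ, Λ]_SN` of a `2`-vector with itself, as a `3`-vector evaluated on
`(df, dg, dh)`. The sign is that of the Schouten bracket which is a graded Lie bracket with
`[P, Q ∧ R] = [P, Q] ∧ R + (-1)^((p-1)q) Q ∧ [P, R]`, extending the Lie bracket of vector fields;
so `[X ∧ Y, X ∧ Y]_SN = 2 X ∧ Y ∧ [X, Y]`. -/
def schoutenSelf (Λ : BivectorField I N) (f g h : N → ℝ) : N → ℝ :=
  fun p => -2 * (Λ.apply (Λ.apply f g) h p + Λ.apply (Λ.apply g h) f p
    + Λ.apply (Λ.apply h f) g p)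

/-- The Schouten bracket `[E, Λ]_SN` of a vector field with a `2`-vector, i.e. the Lie derivative
of `Λ` along `E`, as a `2`-vector evaluated on `(df, dg)`. -/
def schoutenVector (X : ∀ p : N, TangentSpace I p) (Λ : BivectorField I N) (f g : N → ℝ) : N → ℝ :=
  fun p => dirDeriv X (Λ.apply f g) p - Λ.apply (dirDeriv X f) g p - Λ.apply f (dirDeriv X g) p

/-- The wedge product `E ∧ Λ` of a vector field with a `2`-vector, as a `3`-vector evaluated on
`(df, dg, dh)`. -/
def wedgeVector (X : ∀ p : N, TangentSpace I p) (Λ : BivectorField I N) (f g h : N → ℝ) : N → ℝ :=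
  fun p => dirDeriv X f p * Λ.apply g h p + dirDeriv X g p * Λ.apply h f p
    + dirDeriv X h p * Λ.apply f g p

end BivectorField

variable (I N) in
/-- A Jacobi structure `(Λ, E)` on a manifold: `[Λ, Λ]_SN = -2 E ∧ Λ` and `[E, Λ]_SN = 0`. -/
structure JacobiStructure [IsManifold I ∞ N] where
  bivector : BivectorField I N
  reeb : Cₛ^∞⟮I; E, (TangentSpace I : N → Type _)⟯
  schouten_self : ∀ f g h : N → ℝ, ContMDiff I 𝓘(ℝ, ℝ) ∞ f → ContMDiff I 𝓘(ℝ, ℝ) ∞ g →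
    ContMDiff I 𝓘(ℝ, ℝ) ∞ h → ∀ p,
      bivector.schoutenSelf f g h p = -2 * BivectorField.wedgeVector reeb bivector f g h p
  schouten_reeb : ∀ f g : N → ℝ, ContMDiff I 𝓘(ℝ, ℝ) ∞ f → ContMDiff I 𝓘(ℝ, ℝ) ∞ g → ∀ p,
    BivectorField.schoutenVector reeb bivector f g p = 0

namespace JacobiStructure

variable [IsManifold I ∞ N]

/-- The Jacobi bracket `{f, g} = Λ(df, dg) + f E(g) - g E(f)`. -/
def bracket (J : JacobiStructure I N) (f g : N → ℝ) : N → ℝ :=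
  fun p => J.bivector.apply f g p + f p * dirDeriv J.reeb g p - g p * dirDeriv J.reeb f p

/-- The hamiltonian vector field `X_f = #_Λ(df) + f E`. -/
def hamiltonian (J : JacobiStructure I N) (f : N → ℝ) (p : N) : TangentSpace I p :=
  J.bivector.sharp p (mvfderiv I f p) + f p • J.reeb p

end JacobiStructure

end Jacobi

/-! ## Lie algebroids -/

section Algebroid

variable {E : Type*} [NormedAddCommGroup E] [NormedSpace ℝ E]
  {H : Type*} [TopologicalSpace H] (I : ModelWithCorners ℝ E H)
  {M : Type*} [TopologicalSpace M] [ChartedSpace H M]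
  (F : Type*) [NormedAddCommGroup F] [NormedSpace ℝ F]
  (W : M → Type*) [∀ x, AddCommGroup (W x)] [∀ x, Module ℝ (W x)]
  [∀ x, TopologicalSpace (W x)] [TopologicalSpace (TotalSpace F W)] [FiberBundle F W]
  [VectorBundle ℝ F W]

variable {I F W} in
/-- The module structure over `C^∞(M)` on the space `Γ(W)` of smooth sections. -/
instance ContMDiffSection.instSMulSmoothMap :
    SMul C^∞⟮I, M; 𝓘(ℝ, ℝ), ℝ⟯ Cₛ^∞⟮I; F, W⟯ :=
  ⟨fun f s => ⟨fun x => f x • s x, f.contMDiff.smul_section s.contMDiff⟩⟩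

variable {I F W} in
instance ContMDiffSection.instModuleSmoothMap :
    Module C^∞⟮I, M; 𝓘(ℝ, ℝ), ℝ⟯ Cₛ^∞⟮I; F, W⟯ where
  one_smul s := ContMDiffSection.ext fun x => one_smul ℝ (s x)
  mul_smul f g s := ContMDiffSection.ext fun x => mul_smul (f x) (g x) (s x)
  smul_zero f := ContMDiffSection.ext fun x => smul_zero (f x)
  smul_add f s t := ContMDiffSection.ext fun x => smul_add (f x) (s x) (t x)
  add_smul f g s := ContMDiffSection.ext fun x => add_smul (f x) (g x) (s x)
  zero_smul s := ContMDiffSection.ext fun x => zero_smul ℝ (s x)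

/-- A Lie algebroid structure on a smooth vector bundle `W → M`: a real Lie algebra bracket on the
space of smooth sections and a smooth vector bundle morphism `ρ : W → TM`, the anchor, with
`⟦X, f Y⟧ = f ⟦X, Y⟧ + ρ(X)(f) Y`. -/
structure LieAlgebroid [IsManifold I ∞ M] [ContMDiffVectorBundle ∞ F W I] where
  bracket : Cₛ^∞⟮I; F, W⟯ →ₗ[ℝ] Cₛ^∞⟮I; F, W⟯ →ₗ[ℝ] Cₛ^∞⟮I; F, W⟯
  anchor : ∀ x : M, W x →ₗ[ℝ] TangentSpace I x
  bracket_self : ∀ X, bracket X X = 0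
  jacobi : ∀ X Y Z, bracket X (bracket Y Z) + bracket Y (bracket Z X)
    + bracket Z (bracket X Y) = 0
  anchor_smooth : ContMDiff (I.prod 𝓘(ℝ, F)) I.tangent ∞
    (fun w : TotalSpace F W => (⟨w.proj, anchor w.proj w.snd⟩ : TangentBundle I M))
  leibniz : ∀ (X Y : Cₛ^∞⟮I; F, W⟯) (f : C^∞⟮I, M; 𝓘(ℝ, ℝ), ℝ⟯) (x : M),
    bracket X (f • Y) x = f x • bracket X Y x + mvfderiv I f x (anchor x (X x)) • Y x

variable {I F W} in
/-- A Lie algebroid structure on a special vector bundle `(W, X)` is almost-special if the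
`C^∞(M)`-submodule of `Γ(W)` generated by `X` is an ideal of the Lie algebra `Γ(W)`. -/
def LieAlgebroid.IsAlmostSpecial [IsManifold I ∞ M] [ContMDiffVectorBundle ∞ F W I]
    (L : LieAlgebroid I F W) (X : Cₛ^∞⟮I; F, W⟯) : Prop :=
  ∀ Y : Cₛ^∞⟮I; F, W⟯, ∀ Z ∈ Submodule.span C^∞⟮I, M; 𝓘(ℝ, ℝ), ℝ⟯ {X},
    L.bracket Y Z ∈ Submodule.span C^∞⟮I, M; 𝓘(ℝ, ℝ), ℝ⟯ {X}

end Algebroid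

/-! ## Affine bundles -/

section AffineBundle

variable {E : Type*} [NormedAddCommGroup E] [NormedSpace ℝ E]
  {H : Type*} [TopologicalSpace H] (I : ModelWithCorners ℝ E H)
  {M : Type*} [TopologicalSpace M] [ChartedSpace H M]
  (F : Type*) [NormedAddCommGroup F] [NormedSpace ℝ F]
  {V : M → Type*} [∀ x, AddCommGroup (V x)] [∀ x, Module ℝ (V x)]
  (A : M → Type*) [∀ x, AddTorsor (V x) (A x)]
  [∀ x, TopologicalSpace (A x)] [TopologicalSpace (TotalSpace F A)] [FiberBundle F A]

/-- A bundle `A → M` with model fibre `F` is smooth if the transition maps between its local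
trivializations `A|_U ≃ U × F` are smooth. -/
class SmoothFiberBundle : Prop where
  contMDiffOn_symm_trans : ∀ (e e' : Trivialization F (π F A)) [MemTrivializationAtlas e]
    [MemTrivializationAtlas e'], ContMDiffOn (I.prod 𝓘(ℝ, F)) (I.prod 𝓘(ℝ, F)) ∞
      (e.toOpenPartialHomeomorph.symm ≫ₕ e'.toOpenPartialHomeomorph) (e.target ∩ e'.target)

/-- An affine bundle: a locally trivial bundle `A → M`, each fibre `A x` being an affine space
over the vector space `V x`, whose local trivializations `A|_U ≃ U × F` are affine on each fibre.
(The bundle structure of `A` determines that of the bundle of vector spaces `V x`.) -/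
class AffineBundle : Prop where
  exists_affineEquiv : ∀ (e : Trivialization F (π F A)) [MemTrivializationAtlas e] (x : M),
    x ∈ e.baseSet → ∃ φ : A x ≃ᵃ[ℝ] F, ∀ y : A x, (e ⟨x, y⟩).2 = φ y

namespace SmoothFiberBundle

/-- The total space of a smooth bundle is a smooth manifold. -/
instance isManifold_totalSpace [IsManifold I ∞ M] [SmoothFiberBundle I F A] :
    IsManifold (I.prod 𝓘(ℝ, F)) ∞ (TotalSpace F A) := by
  let PG : Pregroupoid (M × F) :=
    { property := fun f u => ContMDiffOn (I.prod 𝓘(ℝ, F)) (I.prod 𝓘(ℝ, F)) ∞ f u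
      comp := fun {f g u v} hf hg _ _ _ =>
        hg.comp (hf.mono inter_subset_left) inter_subset_right
      id_mem := contMDiffOn_id
      locality := fun {f u} _ h => contMDiffOn_of_locally_contMDiffOn h
      congr := fun {f g u} _ h hf => hf.congr h }
  have hG : HasGroupoid (TotalSpace F A) PG.groupoid := by
    refine ⟨?_⟩
    rintro _ _ ⟨e, he, rfl⟩ ⟨e', he', rfl⟩
    have : MemTrivializationAtlas e := ⟨he⟩
    have : MemTrivializationAtlas e' := ⟨he'⟩
    have key : ∀ (e e' : Trivialization F (π F A)) [MemTrivializationAtlas e]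
        [MemTrivializationAtlas e'], ContMDiffOn (I.prod 𝓘(ℝ, F)) (I.prod 𝓘(ℝ, F)) ∞
        (e.toOpenPartialHomeomorph.symm ≫ₕ e'.toOpenPartialHomeomorph)
        (e.toOpenPartialHomeomorph.symm ≫ₕ e'.toOpenPartialHomeomorph).source := by
      intro e e' _ _
      refine (contMDiffOn_symm_trans (I := I) e e').mono ?_
      rintro ⟨b, v⟩ hb
      have h : (b, v) ∈ (e.baseSet ∩ e'.baseSet) ×ˢ (Set.univ : Set F) :=
        (e.symm_trans_source_eq e').subset hb
      exact ⟨e.mem_target.2 h.1.1, e'.mem_target.2 h.1.2⟩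
    exact ⟨key e e', key e' e⟩
  refine { StructureGroupoid.HasGroupoid.comp PG.groupoid ?_ with }
  intro e he
  rw [isLocalStructomorphOn_contDiffGroupoid_iff]
  exact he

end SmoothFiberBundle

/-- A real function on the total space of an affine bundle is an affine function if it is smooth
and its restriction to each fibre is affine. -/
def IsAffineFunction (a : TotalSpace F A → ℝ) : Prop :=
  ContMDiff (I.prod 𝓘(ℝ, F)) 𝓘(ℝ, ℝ) ∞ a ∧
    ∀ x : M, ∃ φ : A x →ᵃ[ℝ] ℝ, ∀ y : A x, a ⟨x, y⟩ = φ y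

/-- A vector field on the total space of an affine bundle is affine if it maps affine functions to
affine functions. -/
def IsAffineVectorField (X : ∀ p : TotalSpace F A, TangentSpace (I.prod 𝓘(ℝ, F)) p) : Prop :=
  ∀ b : TotalSpace F A → ℝ, IsAffineFunction I F A b → IsAffineFunction I F A (dirDeriv X b)

variable {I F A} in
/-- A Jacobi structure on an affine bundle is affine if the Jacobi bracket of affine functions is
an affine function. -/
def JacobiStructure.IsAffine [FiniteDimensional ℝ E] [FiniteDimensional ℝ F] [IsManifold I ∞ M]
    [SmoothFiberBundle I F A]
    (J : JacobiStructure (I.prod 𝓘(ℝ, F)) (TotalSpace F A)) : Prop :=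
  ∀ a b : TotalSpace F A → ℝ, IsAffineFunction I F A a → IsAffineFunction I F A b →
    IsAffineFunction I F A (J.bracket a b)

variable {I F A} in
/-- An affine Jacobi structure is strongly-affine if the hamiltonian vector field of each affine
function is affine. -/
def JacobiStructure.IsStronglyAffine [FiniteDimensional ℝ E] [FiniteDimensional ℝ F]
    [IsManifold I ∞ M] [SmoothFiberBundle I F A]
    (J : JacobiStructure (I.prod 𝓘(ℝ, F)) (TotalSpace F A)) : Prop :=
  J.IsAffine ∧ ∀ a : TotalSpace F A → ℝ, IsAffineFunction I F A a →
    IsAffineVectorField I F A (J.hamiltonian a)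

/-! ### The vector dual `A⁺` of an affine bundle -/

variable {M : Type*} {V : M → Type*} [∀ x, AddCommGroup (V x)] [∀ x, Module ℝ (V x)]
  (A : M → Type*) [∀ x, AddTorsor (V x) (A x)] in
/-- The fibre `Aff(A_x, ℝ)` of the vector dual `A⁺` of an affine bundle `A`. -/
def AffDual (x : M) : Type _ := A x →ᵃ[ℝ] ℝ

namespace AffDual

section Fiber

variable {M : Type*} {V : M → Type*} [∀ x, AddCommGroup (V x)] [∀ x, Module ℝ (V x)]
  {A : M → Type*} [∀ x, AddTorsor (V x) (A x)] (x : M)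

instance : AddCommGroup (AffDual A x) := inferInstanceAs (AddCommGroup (A x →ᵃ[ℝ] ℝ))

instance : Module ℝ (AffDual A x) := inferInstanceAs (Module ℝ (A x →ᵃ[ℝ] ℝ))

variable {x} in
/-- The affine function on the fibre `A_x` given by an element of `A⁺_x`. -/
def toAffineMap (a : AffDual A x) : A x →ᵃ[ℝ] ℝ := a

variable (A) in
/-- The constant affine function `1` on `A_x`. -/
def one : AffDual A x := AffineMap.const ℝ (A x) (1 : ℝ)

/-- The topology of pointwise convergence on `Aff(A_x, ℝ)` (for a finite-dimensional fibre, the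
usual topology of a finite-dimensional vector space). -/
instance : TopologicalSpace (AffDual A x) :=
  TopologicalSpace.induced (fun (a : AffDual A x) (y : A x) => a.toAffineMap y) inferInstance

end Fiber

variable [FiniteDimensional ℝ F]

instance finiteDimensional_model : FiniteDimensional ℝ (F →ᴬ[ℝ] ℝ) :=
  (ContinuousAffineMap.decompLinearIsometryEquiv ℝ ℝ F ℝ).symm.toLinearEquiv.finiteDimensional

variable {F A}

/-- The linear isomorphism `Aff(A_x, ℝ) ≃ Aff(F, ℝ)` induced by an affine isomorphism
`A_x ≃ F`. -/
def fiberEquiv {x : M} (φ : A x ≃ᵃ[ℝ] F) : AffDual A x ≃ₗ[ℝ] (F →ᴬ[ℝ] ℝ) where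
  toFun a :=
    { a.toAffineMap.comp (φ.symm : F →ᵃ[ℝ] A x) with
      cont := AffineMap.continuous_of_finiteDimensional
        (a.toAffineMap.comp (φ.symm : F →ᵃ[ℝ] A x)) }
  invFun g := (g : F →ᵃ[ℝ] ℝ).comp (φ : A x →ᵃ[ℝ] F)
  map_add' _ _ := rfl
  map_smul' _ _ := rfl
  left_inv a := by
    refine AffineMap.ext fun y => ?_
    change a.toAffineMap (φ.symm (φ y)) = a.toAffineMap y
    rw [φ.symm_apply_apply]
  right_inv g := by
    refine ContinuousAffineMap.ext fun v => ?_
    change g (φ (φ.symm v)) = g v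
    rw [φ.apply_symm_apply]

theorem fiberEquiv_apply {x : M} (φ : A x ≃ᵃ[ℝ] F) (a : AffDual A x) (v : F) :
    fiberEquiv φ a v = a.toAffineMap (φ.symm v) := rfl

theorem fiberEquiv_symm_apply {x : M} (φ : A x ≃ᵃ[ℝ] F) (g : F →ᴬ[ℝ] ℝ) (y : A x) :
    ((fiberEquiv φ).symm g).toAffineMap y = g (φ y) := rfl

/-- Evaluations, as linear functionals on `Aff(F, ℝ)`. -/
def evalLinear (v : F) : (F →ᴬ[ℝ] ℝ) →ₗ[ℝ] ℝ where
  toFun g := g v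
  map_add' _ _ := rfl
  map_smul' _ _ := rfl

theorem isInducing_fiberEquiv {x : M} (φ : A x ≃ᵃ[ℝ] F) : Topology.IsInducing (fiberEquiv φ) := by
  let ev : (F →ᴬ[ℝ] ℝ) →ₗ[ℝ] (F → ℝ) := LinearMap.pi evalLinear
  have hev : Topology.IsInducing ev := by
    refine (LinearMap.isClosedEmbedding_of_injective (𝕜 := ℝ) (f := ev) ?_).isInducing
    refine LinearMap.ker_eq_bot.2 fun g g' h => ContinuousAffineMap.ext fun v => ?_
    exact congrFun h v
  have hφ : Topology.IsInducing (fun (u : A x → ℝ) (v : F) => u (φ.symm v)) :=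
    (Homeomorph.piCongrLeft (Y := fun _ => ℝ) φ.symm.toEquiv).symm.isInducing
  rw [← hev.of_comp_iff]
  exact hφ.comp ⟨rfl⟩

/-- A separating family of linear functionals on a finite-dimensional space spans its dual. -/
theorem span_of_separating {G ι : Type*} [NormedAddCommGroup G] [NormedSpace ℝ G]
    [FiniteDimensional ℝ G] (ℓ : ι → G →ₗ[ℝ] ℝ) (hℓ : ∀ g, (∀ i, ℓ i g = 0) → g = 0) :
    Submodule.span ℝ (range ℓ) = ⊤ := by
  rw [← Subspace.dualCoannihilator_dualAnnihilator_eq (W := Submodule.span ℝ (range ℓ))]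
  have : (Submodule.span ℝ (range ℓ)).dualCoannihilator = ⊥ := by
    rw [eq_bot_iff]
    intro g hg
    rw [Submodule.mem_dualCoannihilator] at hg
    exact hℓ g fun i => hg _ (Submodule.subset_span ⟨i, rfl⟩)
  rw [this, Submodule.dualAnnihilator_bot]

theorem continuousOn_of_separating {G ι : Type*} [NormedAddCommGroup G] [NormedSpace ℝ G]
    [FiniteDimensional ℝ G] (ℓ : ι → G →ₗ[ℝ] ℝ) (hℓ : ∀ g, (∀ i, ℓ i g = 0) → g = 0)
    {f : M → G} {s : Set M} (hf : ∀ i, ContinuousOn (fun x => ℓ i (f x)) s) :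
    ContinuousOn f s := by
  have hall : ∀ m : Module.Dual ℝ G, ContinuousOn (fun x => m (f x)) s := by
    intro m
    have hm : m ∈ Submodule.span ℝ (range ℓ) := span_of_separating ℓ hℓ ▸ Submodule.mem_top
    induction hm using Submodule.span_induction with
    | mem m hm => obtain ⟨i, rfl⟩ := hm; exact hf i
    | zero => exact continuousOn_const
    | add m m' _ _ h h' => exact h.add h'
    | smul c m _ h => exact continuousOn_const.mul h
  let b := Module.finBasis ℝ G
  have hcoord : ContinuousOn (fun x => b.equivFunL (f x)) s :=
    continuousOn_pi.2 fun i => hall (b.coord i)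
  refine (b.equivFunL.symm.continuous.comp_continuousOn hcoord).congr fun x _ => ?_
  simp

theorem contMDiffOn_of_separating {G ι : Type*} [NormedAddCommGroup G] [NormedSpace ℝ G]
    [FiniteDimensional ℝ G] (ℓ : ι → G →ₗ[ℝ] ℝ) (hℓ : ∀ g, (∀ i, ℓ i g = 0) → g = 0)
    {f : M → G} {s : Set M} (hf : ∀ i, ContMDiffOn I 𝓘(ℝ, ℝ) ∞ (fun x => ℓ i (f x)) s) :
    ContMDiffOn I 𝓘(ℝ, G) ∞ f s := by
  have hall : ∀ m : Module.Dual ℝ G, ContMDiffOn I 𝓘(ℝ, ℝ) ∞ (fun x => m (f x)) s := by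
    intro m
    have hm : m ∈ Submodule.span ℝ (range ℓ) := span_of_separating ℓ hℓ ▸ Submodule.mem_top
    induction hm using Submodule.span_induction with
    | mem m hm => obtain ⟨i, rfl⟩ := hm; exact hf i
    | zero => exact contMDiffOn_const
    | add m m' _ _ h h' => exact h.add h'
    | smul c m _ h => exact contMDiffOn_const.mul h
  let b := Module.finBasis ℝ G
  have hcoord : ContMDiffOn I 𝓘(ℝ, Fin (Module.finrank ℝ G) → ℝ) ∞
      (fun x => b.equivFunL (f x)) s :=
    contMDiffOn_pi_space.2 fun i => hall (b.coord i)
  refine (b.equivFunL.symm.contDiff.contMDiff.comp_contMDiffOn hcoord).congr fun x _ => ?_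
  simp

variable [AffineBundle F A]

variable (e e' : Trivialization F (π F A)) [MemTrivializationAtlas e] [MemTrivializationAtlas e']

/-- The affine isomorphism `A_x ≃ F` given by a local trivialization. -/
def trivEquiv (x : M) (hx : x ∈ e.baseSet) : A x ≃ᵃ[ℝ] F :=
  (AffineBundle.exists_affineEquiv e x hx).choose

theorem trivEquiv_apply (x : M) (hx : x ∈ e.baseSet) (y : A x) :
    trivEquiv e x hx y = (e ⟨x, y⟩).2 :=
  ((AffineBundle.exists_affineEquiv e x hx).choose_spec y).symm

theorem mk_trivEquiv_symm (x : M) (hx : x ∈ e.baseSet) (v : F) :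
    (⟨x, (trivEquiv e x hx).symm v⟩ : TotalSpace F A)
      = e.toOpenPartialHomeomorph.symm (x, v) := by
  have h1 : (⟨x, (trivEquiv e x hx).symm v⟩ : TotalSpace F A) ∈ e.source := e.mem_source.2 hx
  have h2 : e ⟨x, (trivEquiv e x hx).symm v⟩ = (x, v) := by
    refine Prod.ext (e.coe_fst h1) ?_
    rw [← trivEquiv_apply e x hx, AffineEquiv.apply_symm_apply]
  rw [← h2]
  exact (e.toOpenPartialHomeomorph.left_inv h1).symm

open Classical in
/-- The local trivialization `A⁺|_U ≃ U × Aff(F, ℝ)`, `a ↦ a ∘ φ_x⁻¹`, induced by a local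
trivialization `φ` of the affine bundle `A`. -/
def pretrivialization : Pretrivialization (F →ᴬ[ℝ] ℝ) (π (F →ᴬ[ℝ] ℝ) (AffDual A)) where
  toFun p := ⟨p.1, if hx : p.1 ∈ e.baseSet then fiberEquiv (trivEquiv e p.1 hx) p.2 else 0⟩
  invFun p := ⟨p.1, if hx : p.1 ∈ e.baseSet then
    (fiberEquiv (trivEquiv e p.1 hx)).symm p.2 else 0⟩
  source := Bundle.TotalSpace.proj ⁻¹' e.baseSet
  target := e.baseSet ×ˢ Set.univ
  map_source' := fun ⟨_, _⟩ h => ⟨h, Set.mem_univ _⟩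
  map_target' := fun ⟨_, _⟩ h => h.1
  left_inv' := fun ⟨x, a⟩ h => by
    have hx : x ∈ e.baseSet := h
    simp [hx]
  right_inv' := fun ⟨x, g⟩ h => by
    have hx : x ∈ e.baseSet := h.1
    simp [hx]
  open_target := e.open_baseSet.prod isOpen_univ
  baseSet := e.baseSet
  open_baseSet := e.open_baseSet
  source_eq := rfl
  target_eq := rfl
  proj_toFun _ _ := rfl

theorem pretrivialization_apply {x : M} (hx : x ∈ e.baseSet) (a : AffDual A x) :
    pretrivialization e ⟨x, a⟩ = (x, fiberEquiv (trivEquiv e x hx) a) := by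
  change (x, _) = _
  simp [hx]

open Classical in
theorem pretrivialization_symm_apply {x : M} (hx : x ∈ e.baseSet) (g : F →ᴬ[ℝ] ℝ) :
    (pretrivialization e).symm x g = (fiberEquiv (trivEquiv e x hx)).symm g := by
  rw [Pretrivialization.symm_apply _ (show x ∈ (pretrivialization e).baseSet from hx)]
  change (if h : x ∈ e.baseSet then (fiberEquiv (trivEquiv e x h)).symm g else 0) = _
  rw [dif_pos hx]

instance pretrivialization_isLinear : (pretrivialization e).IsLinear ℝ where
  linear x hx :=
    { map_add := fun a b => by
        change (pretrivialization e ⟨x, a + b⟩).2 =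
          (pretrivialization e ⟨x, a⟩).2 + (pretrivialization e ⟨x, b⟩).2
        simp only [pretrivialization_apply e hx, map_add]
      map_smul := fun c a => by
        change (pretrivialization e ⟨x, c • a⟩).2 = c • (pretrivialization e ⟨x, a⟩).2
        simp only [pretrivialization_apply e hx, map_smul] }

open Classical in
/-- Coordinate changes of `A⁺`: precomposition with the inverse of those of `A`. -/
def coordChange (x : M) : (F →ᴬ[ℝ] ℝ) →L[ℝ] (F →ᴬ[ℝ] ℝ) :=
  if hx : x ∈ e.baseSet ∩ e'.baseSet then
    LinearMap.toContinuousLinearMap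
      (((fiberEquiv (trivEquiv e x hx.1)).symm.trans
        (fiberEquiv (trivEquiv e' x hx.2))).toLinearMap)
  else 0

theorem coordChange_of_mem {x : M} (hx : x ∈ e.baseSet ∩ e'.baseSet) (g : F →ᴬ[ℝ] ℝ) :
    coordChange e e' x g = (pretrivialization e' ⟨x, (pretrivialization e).symm x g⟩).2 := by
  rw [pretrivialization_symm_apply e hx.1, pretrivialization_apply e' hx.2, coordChange,
    dif_pos hx]
  rfl

theorem coordChange_apply {x : M} (hx : x ∈ e.baseSet ∩ e'.baseSet) (g : F →ᴬ[ℝ] ℝ) (v : F) :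
    coordChange e e' x g v = g (e (e'.toOpenPartialHomeomorph.symm (x, v))).2 := by
  rw [coordChange, dif_pos hx, ← mk_trivEquiv_symm e' x hx.2, ← trivEquiv_apply e x hx.1]
  rfl

theorem continuousOn_coordChange :
    ContinuousOn (coordChange e e') (e.baseSet ∩ e'.baseSet) := by
  refine continuousOn_of_separating
    (G := (F →ᴬ[ℝ] ℝ) →L[ℝ] (F →ᴬ[ℝ] ℝ)) (ι := (F →ᴬ[ℝ] ℝ) × F)
    (fun i => (evalLinear i.2).comp
      ((ContinuousLinearMap.apply ℝ (F →ᴬ[ℝ] ℝ) i.1).toLinearMap)) ?_ ?_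
  · intro T hT
    ext g v
    exact hT (g, v)
  · rintro ⟨g, v⟩
    have h1 : ContinuousOn (fun x : M => e'.toOpenPartialHomeomorph.symm (x, v))
        (e.baseSet ∩ e'.baseSet) :=
      e'.toOpenPartialHomeomorph.continuousOn_symm.comp
        (continuous_id.prodMk continuous_const).continuousOn
        (fun x hx => e'.mem_target.2 hx.2)
    have h2 : ContinuousOn (fun x : M => e (e'.toOpenPartialHomeomorph.symm (x, v)))
        (e.baseSet ∩ e'.baseSet) := by
      refine e.continuousOn.comp h1 fun x hx => ?_
      rw [e.mem_source, e'.proj_symm_apply (e'.mem_target.2 hx.2)]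
      exact hx.1
    refine (g.continuous.comp_continuousOn (continuous_snd.comp_continuousOn h2)).congr
      fun x hx => ?_
    exact coordChange_apply e e' hx g v

theorem contMDiffOn_coordChange [SmoothFiberBundle I F A] :
    ContMDiffOn I 𝓘(ℝ, (F →ᴬ[ℝ] ℝ) →L[ℝ] (F →ᴬ[ℝ] ℝ)) ∞ (coordChange e e')
      (e.baseSet ∩ e'.baseSet) := by
  refine contMDiffOn_of_separating I
    (G := (F →ᴬ[ℝ] ℝ) →L[ℝ] (F →ᴬ[ℝ] ℝ)) (ι := (F →ᴬ[ℝ] ℝ) × F)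
    (fun i => (evalLinear i.2).comp
      ((ContinuousLinearMap.apply ℝ (F →ᴬ[ℝ] ℝ) i.1).toLinearMap)) ?_ ?_
  · intro T hT
    ext g v
    exact hT (g, v)
  · rintro ⟨g, v⟩
    have h1 := SmoothFiberBundle.contMDiffOn_symm_trans (I := I) e' e
    have h2 : ContMDiffOn I (I.prod 𝓘(ℝ, F)) ∞ (fun x : M => (x, v))
        (e.baseSet ∩ e'.baseSet) := contMDiffOn_id.prodMk contMDiffOn_const
    have h3 := h1.comp h2 (fun x hx => ⟨e'.mem_target.2 hx.2, e.mem_target.2 hx.1⟩)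
    have h4 : ContMDiffOn I 𝓘(ℝ, F) ∞
        (fun x => (e (e'.toOpenPartialHomeomorph.symm (x, v))).2) (e.baseSet ∩ e'.baseSet) :=
      contMDiff_snd.comp_contMDiffOn h3
    refine (g.contDiff.contMDiff.comp_contMDiffOn h4).congr fun x hx => ?_
    exact coordChange_apply e e' hx g v

variable (F A)

/-- The vector bundle structure of the vector dual `A⁺`, with the local trivializations induced
by those of `A`. -/
def vectorPrebundle : VectorPrebundle ℝ (F →ᴬ[ℝ] ℝ) (AffDual A) where
  pretrivializationAtlas := {f | ∃ (e : Trivialization F (π F A)) (_ : MemTrivializationAtlas e),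
    f = pretrivialization e}
  pretrivialization_linear' := by
    rintro _ ⟨e, he, rfl⟩
    infer_instance
  pretrivializationAt x := pretrivialization (trivializationAt F A x)
  mem_base_pretrivializationAt x := mem_baseSet_trivializationAt F A x
  pretrivialization_mem_atlas x := ⟨trivializationAt F A x, inferInstance, rfl⟩
  exists_coordChange := by
    rintro _ ⟨e, he, rfl⟩ _ ⟨e', he', rfl⟩
    refine ⟨coordChange e e', continuousOn_coordChange e e', ?_⟩
    intro x hx g
    exact coordChange_of_mem e e' hx g
  totalSpaceMk_isInducing x := by
    have hx := mem_baseSet_trivializationAt F A x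
    have h : Topology.IsInducing fun a : AffDual A x =>
        (x, fiberEquiv (trivEquiv (trivializationAt F A x) x hx) a) :=
      Topology.isInducing_const_prod.mpr (isInducing_fiberEquiv _)
    convert! h using 2 with a
    exact pretrivialization_apply _ hx a

instance topologicalSpace_totalSpace : TopologicalSpace (TotalSpace (F →ᴬ[ℝ] ℝ) (AffDual A)) :=
  (vectorPrebundle F A).totalSpaceTopology

instance fiberBundle : FiberBundle (F →ᴬ[ℝ] ℝ) (AffDual A) :=
  (vectorPrebundle F A).toFiberBundle

instance vectorBundle : VectorBundle ℝ (F →ᴬ[ℝ] ℝ) (AffDual A) :=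
  (vectorPrebundle F A).toVectorBundle

instance isContMDiff_vectorPrebundle [SmoothFiberBundle I F A] :
    (vectorPrebundle F A).IsContMDiff I ∞ where
  exists_contMDiffCoordChange := by
    rintro _ ⟨e, he, rfl⟩ _ ⟨e', he', rfl⟩
    exact ⟨coordChange e e', contMDiffOn_coordChange I e e',
      fun x hx g => coordChange_of_mem e e' hx g⟩

/-- The vector dual `A⁺` of a smooth affine bundle is a smooth vector bundle. -/
instance contMDiffVectorBundle [SmoothFiberBundle I F A] :
    ContMDiffVectorBundle ∞ (F →ᴬ[ℝ] ℝ) (AffDual A) I :=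
  (vectorPrebundle F A).contMDiffVectorBundle I

variable {A} in
theorem trivializationAt_apply (x₀ : M) {x : M} (hx : x ∈ (trivializationAt F A x₀).baseSet)
    (a : AffDual A x) :
    trivializationAt (F →ᴬ[ℝ] ℝ) (AffDual A) x₀ ⟨x, a⟩
      = (x, fiberEquiv (trivEquiv (trivializationAt F A x₀) x hx) a) :=
  pretrivialization_apply (trivializationAt F A x₀) hx a

/-- The distinguished section `1̃` of `A⁺`, whose value at `x` is the constant function `1` on
`A_x`. -/
def oneSection : Cₛ^∞⟮I; F →ᴬ[ℝ] ℝ, AffDual A⟯ where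
  toFun x := one A x
  contMDiff_toFun := by
    intro x₀
    rw [contMDiffAt_section]
    refine (contMDiffAt_const (c := ContinuousAffineMap.const ℝ F (1 : ℝ))).congr_of_eventuallyEq ?_
    filter_upwards [(trivializationAt F A x₀).open_baseSet.mem_nhds
      (mem_baseSet_trivializationAt F A x₀)] with x hx
    rw [trivializationAt_apply F x₀ hx]
    rfl

variable {I F A} in
/-- The affine function `a : A → ℝ` associated with a section `ã` of `A⁺`. -/
def toFunction (s : Cₛ^∞⟮I; F →ᴬ[ℝ] ℝ, AffDual A⟯) : TotalSpace F A → ℝ :=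
  fun p => (s p.proj).toAffineMap p.snd

end AffDual

end AffineBundle

end

/-!
The square of a nonconstant affine function on a line is not affine. Hence, if `c` is a function
on `A` such that `c` is affine and `b c` is affine for all affine `b`, then `c` is basic, that is,
pulled back from `M`.

For a strongly-affine structure `(Λ, E)` this applies to `c = E(a)` and to `c = X_a(f)` with `f`
basic, by the Leibniz rule: hamiltonian vector fields of affine functions project to `M`, which
gives the anchor. The rank being positive, `Λ(df, dg)` vanishes for basic `f`, `g`, which makes the
anchor linear over functions.

Conversely, in an almost-special Lie algebroid `⟦1, ·⟧` takes values in the multiples of `1`, so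
`ρ(1) = 0`, and both `⟦1, ·⟧` and `⟦a, b⟧ - a ⟦1, b⟧ + b ⟦1, a⟧` are derivations in `a` and `b`.
The differentials of affine functions span every cotangent space, and so these derivations come
from a unique vector field `E` and a unique bivector field `Λ`. Finally, for any pair `(Λ, E)` the
Jacobiator of the bracket is `½ ([Λ, Λ] + 2 E ∧ Λ)` plus terms `f [E, Λ](g, h)`; these tensors
vanish as soon as the Jacobiator vanishes on affine functions.
-/

noncomputable section

section DirectionalDerivative

variable {E : Type*} [NormedAddCommGroup E] [NormedSpace ℝ E]
  {H : Type*} [TopologicalSpace H] {I : ModelWithCorners ℝ E H}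
  {N : Type*} [TopologicalSpace N] [ChartedSpace H N]

theorem mvfderiv_congr {f g : N → ℝ} {p : N} (h : f =ᶠ[𝓝 p] g) :
    mvfderiv I f p = mvfderiv I g p := by
  ext v
  exact congrArg (fun L : E →L[ℝ] ℝ => L v) (h.mfderiv_eq (I := I) (I' := 𝓘(ℝ, ℝ)))

theorem mvfderiv_extChartAt_symm [IsManifold I 1 N] {f : N → ℝ} {p₀ : N} {y : E}
    (hy : y ∈ (extChartAt I p₀).target)
    (hf : MDifferentiableAt I 𝓘(ℝ, ℝ) f ((extChartAt I p₀).symm y)) (v : E) :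
    mvfderiv I f ((extChartAt I p₀).symm y)
        (mfderivWithin 𝓘(ℝ, E) I (extChartAt I p₀).symm (range I) y v)
      = fderivWithin ℝ (f ∘ (extChartAt I p₀).symm) (range I) y v := by
  have h := mvfderiv_comp_mfderivWithin (I := I) (I' := 𝓘(ℝ, E)) (s := range I) y hf
    (mdifferentiableWithinAt_extChartAt_symm hy)
    (I.uniqueMDiffOn y (extChartAt_target_subset_range p₀ hy))
  refine (DFunLike.congr_fun h v).symm.trans ?_
  change mfderivWithin 𝓘(ℝ, E) 𝓘(ℝ, ℝ) _ _ _ v = _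
  rw [mfderivWithin_eq_fderivWithin]
  rfl

variable (I) in
/-- The expression of a vector field in the preferred chart at `p₀`. -/
def chartField (p₀ : N) (X : ∀ p : N, TangentSpace I p) : E → E :=
  VectorField.mpullbackWithin 𝓘(ℝ, E) I (extChartAt I p₀).symm X (range I)

theorem dirDeriv_extChartAt_symm [CompleteSpace E] [IsManifold I 1 N]
    (X : ∀ p : N, TangentSpace I p)
    {f : N → ℝ} {p₀ : N} {y : E} (hy : y ∈ (extChartAt I p₀).target)
    (hf : MDifferentiableAt I 𝓘(ℝ, ℝ) f ((extChartAt I p₀).symm y)) :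
    dirDeriv X f ((extChartAt I p₀).symm y)
      = fderivWithin ℝ (f ∘ (extChartAt I p₀).symm) (range I) y (chartField I p₀ X y) := by
  rw [← mvfderiv_extChartAt_symm hy hf]
  exact congrArg (mvfderiv I f _)
    ((isInvertible_mfderivWithin_extChartAt_symm hy).self_apply_inverse _).symm

section Commutator

variable [IsManifold I 2 N]
  {X Y : ∀ p : N, TangentSpace I p} {f : N → ℝ} {p : N}

theorem differentiableWithinAt_chartField [CompleteSpace E]
    (hX : MDifferentiableAt I I.tangent (fun q => (⟨q, X q⟩ : TangentBundle I N)) p) :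
    DifferentiableWithinAt ℝ (chartField I p X) (range I) (extChartAt I p p) := by
  have h := (hX.mdifferentiableWithinAt
    (s := univ)).differentiableWithinAt_mpullbackWithin_vectorField
  rwa [preimage_univ, univ_inter] at h

theorem dirDeriv_dirDeriv_eq_chart [CompleteSpace E]
    (hY : MDifferentiableAt I I.tangent (fun q => (⟨q, Y q⟩ : TangentBundle I N)) p)
    (hf : ContMDiffAt I 𝓘(ℝ, ℝ) 2 f p) :
    dirDeriv X (dirDeriv Y f) p
      = fderivWithin ℝ (fderivWithin ℝ (f ∘ (extChartAt I p).symm) (range I)) (range I)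
          (extChartAt I p p)
          (chartField I p X (extChartAt I p p)) (chartField I p Y (extChartAt I p p)) +
        fderivWithin ℝ (f ∘ (extChartAt I p).symm) (range I) (extChartAt I p p)
          (fderivWithin ℝ (chartField I p Y) (range I) (extChartAt I p p)
            (chartField I p X (extChartAt I p p))) := by
  set φ := extChartAt I p
  have hφ : φ p ∈ φ.target := mem_extChartAt_target p
  have hU : UniqueDiffWithinAt ℝ (range I) (φ p) := I.uniqueDiffOn _ (mem_range_self _)
  have hf' : ContDiffWithinAt ℝ 2 (f ∘ φ.symm) (range I) (φ p) := (contMDiffAt_iff.1 hf).2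
  have hdf : DifferentiableWithinAt ℝ (fderivWithin ℝ (f ∘ φ.symm) (range I)) (range I) (φ p) :=
    (hf'.fderivWithin_right (m := 1) I.uniqueDiffOn (by norm_num)
      (mem_range_self _)).differentiableWithinAt one_ne_zero
  have hdY := differentiableWithinAt_chartField hY
  have hYf : dirDeriv Y f ∘ φ.symm =ᶠ[𝓝[range I] φ p]
      fun y => fderivWithin ℝ (f ∘ φ.symm) (range I) y (chartField I p Y y) := by
    have hf₁ : ∀ᶠ y in 𝓝[range I] φ p, ContMDiffAt I 𝓘(ℝ, ℝ) 2 f (φ.symm y) :=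
      Filter.Tendsto.eventually (p := fun q => ContMDiffAt I 𝓘(ℝ, ℝ) 2 f q)
        (map_extChartAt_symm_nhdsWithin_range (I := I) p).le
        ((contMDiffAt_iff_contMDiffAt_nhds (by decide)).1 hf)
    filter_upwards [extChartAt_target_mem_nhdsWithin p, hf₁] with y hy hfy
    exact dirDeriv_extChartAt_symm Y hy (hfy.mdifferentiableAt two_ne_zero)
  have hYf' : MDifferentiableAt I 𝓘(ℝ, ℝ) (dirDeriv Y f) p := by
    rw [← mdifferentiableWithinAt_univ]
    refine DifferentiableWithinAt.mdifferentiableWithinAt_of_comp_extChartAt_symm ?_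
    rw [preimage_univ, univ_inter]
    exact (hdf.clm_apply hdY).congr_of_eventuallyEq_of_mem hYf (mem_range_self _)
  have h := dirDeriv_extChartAt_symm X hφ (by rwa [extChartAt_to_inv])
  rw [extChartAt_to_inv] at h
  rw [h, hYf.fderivWithin_eq_of_mem (mem_range_self _), fderivWithin_clm_apply hU hdf hdY, add_comm]
  rfl

theorem mvfderiv_mlieBracket_eq_chart (hf : MDifferentiableAt I 𝓘(ℝ, ℝ) f p) :
    mvfderiv I f p (VectorField.mlieBracket I X Y p) =
      fderivWithin ℝ (f ∘ (extChartAt I p).symm) (range I) (extChartAt I p p)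
        (VectorField.lieBracketWithin ℝ (chartField I p X) (chartField I p Y) (range I)
          (extChartAt I p p)) := by
  rw [← mvfderiv_extChartAt_symm (mem_extChartAt_target p) (by rwa [extChartAt_to_inv]),
    mfderivWithin_range_extChartAt_symm, extChartAt_to_inv, ← VectorField.mlieBracketWithin_univ,
    VectorField.mlieBracketWithin_apply, mfderiv_extChartAt_self, preimage_univ, univ_inter]
  exact congrArg (mvfderiv I f p)
    (DFunLike.congr_fun (ContinuousLinearMap.inverse_id (R := ℝ) (M := E)) _)

theorem dirDeriv_dirDeriv_sub_swap [CompleteSpace E]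
    (hX : MDifferentiableAt I I.tangent (fun q => (⟨q, X q⟩ : TangentBundle I N)) p)
    (hY : MDifferentiableAt I I.tangent (fun q => (⟨q, Y q⟩ : TangentBundle I N)) p)
    (hf : ContMDiffAt I 𝓘(ℝ, ℝ) 2 f p) :
    dirDeriv X (dirDeriv Y f) p - dirDeriv Y (dirDeriv X f) p
      = mvfderiv I f p (VectorField.mlieBracket I X Y p) := by
  have hf' : ContDiffWithinAt ℝ 2 (f ∘ (extChartAt I p).symm) (range I) (extChartAt I p p) :=
    (contMDiffAt_iff.1 hf).2
  have hsymm := (hf'.isSymmSndFDerivWithinAt (by simp) I.uniqueDiffOn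
    (I.range_subset_closure_interior (mem_range_self _)) (mem_range_self _)).eq
      (chartField I p X (extChartAt I p p)) (chartField I p Y (extChartAt I p p))
  rw [dirDeriv_dirDeriv_eq_chart hY hf, dirDeriv_dirDeriv_eq_chart hX hf, hsymm,
    mvfderiv_mlieBracket_eq_chart (hf.mdifferentiableAt two_ne_zero),
    VectorField.lieBracketWithin, map_sub]
  ring

end Commutator

section Algebra

variable (X : ∀ p : N, TangentSpace I p) {f g : N → ℝ} {p : N}

theorem dirDeriv_fun_const (c : ℝ) : dirDeriv X (fun _ => c) = fun _ => 0 := by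
  funext p
  simp [dirDeriv, mvfderiv_const]

theorem dirDeriv_fun_add (hf : MDifferentiableAt I 𝓘(ℝ, ℝ) f p)
    (hg : MDifferentiableAt I 𝓘(ℝ, ℝ) g p) :
    dirDeriv X (fun q => f q + g q) p = dirDeriv X f p + dirDeriv X g p :=
  DFunLike.congr_fun (mvfderiv_fun_add hf hg) (X p)

theorem dirDeriv_fun_sub (hf : MDifferentiableAt I 𝓘(ℝ, ℝ) f p)
    (hg : MDifferentiableAt I 𝓘(ℝ, ℝ) g p) :
    dirDeriv X (fun q => f q - g q) p = dirDeriv X f p - dirDeriv X g p :=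
  DFunLike.congr_fun (mvfderiv_fun_sub hf hg) (X p)

theorem dirDeriv_fun_neg : dirDeriv X (fun q => - f q) p = - dirDeriv X f p :=
  DFunLike.congr_fun (mvfderiv_fun_neg ..) (X p)

theorem dirDeriv_fun_mul (hf : MDifferentiableAt I 𝓘(ℝ, ℝ) f p)
    (hg : MDifferentiableAt I 𝓘(ℝ, ℝ) g p) :
    dirDeriv X (fun q => f q * g q) p = f p * dirDeriv X g p + g p * dirDeriv X f p :=
  DFunLike.congr_fun (mvfderiv_fun_mul hf hg) (X p)

end Algebra

theorem contMDiffAt_dirDeriv [IsManifold I ∞ N] {X : ∀ p : N, TangentSpace I p} {f : N → ℝ} {p : N}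
    (hX : ContMDiffAt I I.tangent ∞ (T% X) p) (hf : ContMDiff I 𝓘(ℝ, ℝ) ∞ f) :
    ContMDiffAt I 𝓘(ℝ, ℝ) ∞ (dirDeriv X f) p :=
  ((contMDiff_snd_tangentBundle_modelSpace ℝ 𝓘(ℝ, ℝ)).comp
    (hf.contMDiff_tangentMap (m := ∞) (by simp))).contMDiffAt.comp p hX

theorem contMDiff_dirDeriv [IsManifold I ∞ N] {X : ∀ p : N, TangentSpace I p} {f : N → ℝ}
    (hX : ContMDiff I I.tangent ∞ (T% X)) (hf : ContMDiff I 𝓘(ℝ, ℝ) ∞ f) :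
    ContMDiff I 𝓘(ℝ, ℝ) ∞ (dirDeriv X f) :=
  fun p => contMDiffAt_dirDeriv (hX p) hf

end DirectionalDerivative

section Coordinates

variable {E : Type*} [NormedAddCommGroup E] [NormedSpace ℝ E]
  {H : Type*} [TopologicalSpace H] {I : ModelWithCorners ℝ E H}
  {N : Type*} [TopologicalSpace N] [ChartedSpace H N]

variable (I) in
/-- The functions `c ℓ` are globally defined smooth functions which coincide near `p₀` with the
coordinates `ℓ` of the preferred chart at `p₀`. Taking for `ℓ` all the linear forms on the model
space, instead of those of a dual basis, makes every covector at `p₀` the differential of some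
`c ℓ`. -/
structure IsCoordFamily (c : Module.Dual ℝ E → N → ℝ) (p₀ : N) : Prop where
  contMDiff : ∀ ℓ, ContMDiff I 𝓘(ℝ, ℝ) ∞ (c ℓ)
  eventuallyEq : ∀ ℓ, c ℓ =ᶠ[𝓝 p₀] fun p => ℓ (extChartAt I p₀ p)

theorem contMDiffAt_of_forall_dual [FiniteDimensional ℝ E] {P : Type*} [TopologicalSpace P]
    {K : Type*} [NormedAddCommGroup K] [NormedSpace ℝ K] {HK : Type*} [TopologicalSpace HK]
    {IK : ModelWithCorners ℝ K HK} [ChartedSpace HK P] {n : ℕ∞ω} {u : P → E} {p : P}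
    (hu : ∀ ℓ : Module.Dual ℝ E, ContMDiffAt IK 𝓘(ℝ, ℝ) n (fun x => ℓ (u x)) p) :
    ContMDiffAt IK 𝓘(ℝ, E) n u p := by
  let b := Module.finBasis ℝ E
  have hsum : ContMDiffAt IK 𝓘(ℝ, E) n (fun x => ∑ i, b.coord i (u x) • b i) p :=
    ContMDiffAt.sum fun i _ => (hu (b.coord i)).smul contMDiffAt_const
  exact hsum.congr_of_eventuallyEq (.of_forall fun x => (b.sum_repr (u x)).symm)

namespace IsCoordFamily

variable [FiniteDimensional ℝ E] {c : Module.Dual ℝ E → N → ℝ} {p₀ : N}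

theorem eventually_mvfderiv_eq [IsManifold I 1 N] (hc : IsCoordFamily I c p₀)
    (ℓ : Module.Dual ℝ E) :
    ∀ᶠ p in 𝓝 p₀, ∀ v : TangentSpace I p,
      mvfderiv I (c ℓ) p v = ℓ (mfderiv I 𝓘(ℝ, E) (extChartAt I p₀) p v) := by
  filter_upwards [(hc.eventuallyEq ℓ).eventually_nhds, extChartAt_source_mem_nhds (I := I) p₀]
    with p hp hps v
  have hp' : c ℓ =ᶠ[𝓝 p] ℓ.toContinuousLinearMap ∘ extChartAt I p₀ := hp
  rw [mvfderiv_congr hp', mvfderiv_comp_apply p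
    ℓ.toContinuousLinearMap.differentiableAt.mdifferentiableAt
    (mdifferentiableAt_extChartAt (by rwa [extChartAt_source] at hps))]
  change mfderiv 𝓘(ℝ, E) 𝓘(ℝ, ℝ) ℓ.toContinuousLinearMap (extChartAt I p₀ p) _ = _
  rw [mfderiv_eq_fderiv, ContinuousLinearMap.fderiv]
  rfl

theorem mvfderiv_self [IsManifold I 1 N] (hc : IsCoordFamily I c p₀) (ℓ : Module.Dual ℝ E)
    (v : TangentSpace I p₀) : mvfderiv I (c ℓ) p₀ v = ℓ v := by
  rw [(hc.eventually_mvfderiv_eq ℓ).self_of_nhds v, mfderiv_extChartAt_self]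
  rfl

theorem exists_mvfderiv_eq [IsManifold I 1 N] (hc : IsCoordFamily I c p₀)
    (β : TangentSpace I p₀ →L[ℝ] ℝ) : ∃ ℓ, mvfderiv I (c ℓ) p₀ = β :=
  ⟨β.toLinearMap, ContinuousLinearMap.ext fun v => hc.mvfderiv_self _ v⟩

theorem eq_of_mvfderiv_eq [IsManifold I 1 N] (hc : IsCoordFamily I c p₀)
    {v w : TangentSpace I p₀} (hvw : ∀ ℓ, mvfderiv I (c ℓ) p₀ v = mvfderiv I (c ℓ) p₀ w) :
    v = w :=
  (Module.forall_dual_apply_eq_zero_iff ℝ (V := E) (v - w)).1 (fun ℓ => by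
    have := hvw ℓ
    rw [hc.mvfderiv_self, hc.mvfderiv_self] at this
    exact (map_sub ℓ v w).trans (sub_eq_zero.2 this)) |> sub_eq_zero.1

theorem contMDiffAt_vectorField [IsManifold I ∞ N] (hc : IsCoordFamily I c p₀)
    {X : ∀ p : N, TangentSpace I p}
    (hX : ∀ ℓ, ContMDiffAt I 𝓘(ℝ, ℝ) ∞ (dirDeriv X (c ℓ)) p₀) :
    ContMDiffAt I I.tangent ∞ (T% X) p₀ := by
  rw [Bundle.contMDiffAt_section]
  have hv : ContMDiffAt I 𝓘(ℝ, E) ∞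
      (fun p => (mfderiv I 𝓘(ℝ, E) (extChartAt I p₀) p (X p) : E)) p₀ :=
    contMDiffAt_of_forall_dual fun ℓ => (hX ℓ).congr_of_eventuallyEq
      ((hc.eventually_mvfderiv_eq ℓ).mono fun p hp => (hp (X p)).symm)
  refine hv.congr_of_eventuallyEq ?_
  filter_upwards [extChartAt_source_mem_nhds (I := I) p₀] with p hp
  rw [extChartAt_source] at hp
  rw [← TangentBundle.continuousLinearMapAt_trivializationAt hp]
  exact (Trivialization.continuousLinearMapAt_apply_of_mem ℝ _ hp _).symm

theorem contMDiffAt_dual_mvfderiv [IsManifold I ∞ N] (hc : IsCoordFamily I c p₀)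
    {D : ∀ p : N, Module.Dual ℝ (Module.Dual ℝ (TangentSpace I p))}
    (hD : ∀ ℓ, ContMDiffAt I 𝓘(ℝ, ℝ) ∞ (fun p => D p (mvfderiv I (c ℓ) p)) p₀)
    {f : N → ℝ} (hf : ContMDiff I 𝓘(ℝ, ℝ) ∞ f) :
    ContMDiffAt I 𝓘(ℝ, ℝ) ∞ (fun p => D p (mvfderiv I f p)) p₀ := by
  have (p : N) : FiniteDimensional ℝ (TangentSpace I p) :=
    inferInstanceAs (FiniteDimensional ℝ E)
  let X (p : N) : TangentSpace I p := (Module.evalEquiv ℝ (TangentSpace I p)).symm (D p)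
  have hX (g : N → ℝ) : dirDeriv X g = fun p => D p (mvfderiv I g p) := funext fun p =>
    Module.apply_evalEquiv_symm_apply ℝ _ (mvfderiv I g p).toLinearMap (D p)
  rw [← hX]
  exact contMDiffAt_dirDeriv (hc.contMDiffAt_vectorField fun ℓ => hX (c ℓ) ▸ hD ℓ) hf

theorem contMDiffAt_bilinForm_mvfderiv [IsManifold I ∞ N] (hc : IsCoordFamily I c p₀)
    {Λ : ∀ p : N, LinearMap.BilinForm ℝ (Module.Dual ℝ (TangentSpace I p))}
    (hΛ : ∀ ℓ ℓ', ContMDiffAt I 𝓘(ℝ, ℝ) ∞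
      (fun p => Λ p (mvfderiv I (c ℓ) p) (mvfderiv I (c ℓ') p)) p₀)
    {f g : N → ℝ} (hf : ContMDiff I 𝓘(ℝ, ℝ) ∞ f) (hg : ContMDiff I 𝓘(ℝ, ℝ) ∞ g) :
    ContMDiffAt I 𝓘(ℝ, ℝ) ∞ (fun p => Λ p (mvfderiv I f p) (mvfderiv I g p)) p₀ :=
  hc.contMDiffAt_dual_mvfderiv (D := fun p => (Λ p).flip (mvfderiv I g p))
    (fun ℓ => hc.contMDiffAt_dual_mvfderiv (D := fun p => Λ p (mvfderiv I (c ℓ) p)) (hΛ ℓ) hg) hf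

end IsCoordFamily

end Coordinates

section Bivector

variable {E : Type*} [NormedAddCommGroup E] [NormedSpace ℝ E]
  {H : Type*} [TopologicalSpace H] {I : ModelWithCorners ℝ E H}
  {N : Type*} [TopologicalSpace N] [ChartedSpace H N]

namespace BivectorField

variable (Λ : BivectorField I N)

theorem contMDiff_apply {f g : N → ℝ} (hf : ContMDiff I 𝓘(ℝ, ℝ) ∞ f)
    (hg : ContMDiff I 𝓘(ℝ, ℝ) ∞ g) : ContMDiff I 𝓘(ℝ, ℝ) ∞ (Λ.apply f g) :=
  Λ.smooth f g hf hg

theorem apply_swap (f g : N → ℝ) (p : N) : Λ.apply f g p = - Λ.apply g f p :=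
  (LinearMap.IsAlt.neg (B := Λ.toFun p) (Λ.alternating p) _ _).symm

theorem apply_swap_fun (f g : N → ℝ) : Λ.apply f g = fun p => - Λ.apply g f p :=
  funext (Λ.apply_swap f g)

theorem schoutenVector_swap (X : ∀ p : N, TangentSpace I p) (f g : N → ℝ) (p : N) :
    schoutenVector X Λ f g p = - schoutenVector X Λ g f p := by
  simp only [schoutenVector, Λ.apply_swap_fun f g, Λ.apply_swap f, Λ.apply_swap _ g,
    dirDeriv_fun_neg]
  ring

theorem schoutenSelf_rotate (f g h : N → ℝ) (p : N) :
    Λ.schoutenSelf f g h p = Λ.schoutenSelf g h f p := by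
  unfold schoutenSelf
  ring

theorem wedgeVector_congr {X : ∀ p : N, TangentSpace I p} {f f' g g' h h' : N → ℝ}
    {p : N} (hff' : mvfderiv I f p = mvfderiv I f' p)
    (hgg' : mvfderiv I g p = mvfderiv I g' p) (hhh' : mvfderiv I h p = mvfderiv I h' p) :
    wedgeVector X Λ f g h p = wedgeVector X Λ f' g' h' p := by
  simp only [wedgeVector, apply, dirDeriv, hff', hgg', hhh']

variable [FiniteDimensional ℝ E]

theorem apply_sharp (p : N) (α β : Module.Dual ℝ (TangentSpace I p)) :
    β (Λ.sharp p α) = Λ.toFun p α β :=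
  haveI : FiniteDimensional ℝ (TangentSpace I p) := inferInstanceAs (FiniteDimensional ℝ E)
  Module.apply_evalEquiv_symm_apply ℝ _ β (Λ.toFun p α)

/-- The vector field `#_Λ(df)`, through which `Λ(df, ·)` becomes a derivation of functions. -/
def sharpDiff (f : N → ℝ) (p : N) : TangentSpace I p :=
  Λ.sharp p (mvfderiv I f p)

theorem dirDeriv_sharpDiff (f g : N → ℝ) : dirDeriv (Λ.sharpDiff f) g = Λ.apply f g :=
  funext fun p => Λ.apply_sharp p _ (mvfderiv I g p)

variable {Λ} {f g h : N → ℝ} {p : N}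

theorem apply_fun_const (f : N → ℝ) (c : ℝ) : Λ.apply f (fun _ => c) = fun _ => 0 := by
  rw [← dirDeriv_sharpDiff, dirDeriv_fun_const]

theorem const_apply_fun (c : ℝ) (f : N → ℝ) : Λ.apply (fun _ => c) f = fun _ => 0 := by
  simp only [Λ.apply_swap_fun _ f, apply_fun_const, neg_zero]

end BivectorField

/-- The bracket `{f, g} = Λ(df, dg) + f X(g) - g X(f)` of a pair `(Λ, X)` of a bivector field and
a vector field which need not form a Jacobi structure. -/
def jacobiBracket (Λ : BivectorField I N) (X : ∀ p : N, TangentSpace I p) (f g : N → ℝ) : N → ℝ :=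
  fun p => Λ.apply f g p + f p * dirDeriv X g p - g p * dirDeriv X f p

section Jacobiator

variable [IsManifold I ∞ N] {Λ : BivectorField I N} {X : ∀ p : N, TangentSpace I p}
  {f g h : N → ℝ}

theorem dirDeriv_jacobiBracket (Y : ∀ p : N, TangentSpace I p)
    (hX : ContMDiff I I.tangent ∞ (T% X)) (hf : ContMDiff I 𝓘(ℝ, ℝ) ∞ f)
    (hg : ContMDiff I 𝓘(ℝ, ℝ) ∞ g) (p : N) :
    dirDeriv Y (jacobiBracket Λ X f g) p = dirDeriv Y (Λ.apply f g) p +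
      (f p * dirDeriv Y (dirDeriv X g) p + dirDeriv X g p * dirDeriv Y f p) -
      (g p * dirDeriv Y (dirDeriv X f) p + dirDeriv X f p * dirDeriv Y g p) := by
  have hd {u : N → ℝ} (hu : ContMDiff I 𝓘(ℝ, ℝ) ∞ u) : MDifferentiableAt I 𝓘(ℝ, ℝ) u p :=
    hu.mdifferentiableAt (by simp)
  have hXf := contMDiff_dirDeriv hX hf
  have hXg := contMDiff_dirDeriv hX hg
  have hΛ := Λ.contMDiff_apply hf hg
  exact (dirDeriv_fun_sub Y (hd (hΛ.add (hf.mul hXg))) (hd (hg.mul hXf))).trans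
    (congrArg₂ (· - ·) ((dirDeriv_fun_add Y (hd hΛ) (hd (hf.mul hXg))).trans
      (congrArg (_ + ·) (dirDeriv_fun_mul Y (hd hf) (hd hXg))))
      (dirDeriv_fun_mul Y (hd hg) (hd hXf)))

variable [FiniteDimensional ℝ E]

theorem jacobiBracket_jacobiBracket (hX : ContMDiff I I.tangent ∞ (T% X))
    (f : N → ℝ) (hg : ContMDiff I 𝓘(ℝ, ℝ) ∞ g) (hh : ContMDiff I 𝓘(ℝ, ℝ) ∞ h) (p : N) :
    jacobiBracket Λ X f (jacobiBracket Λ X g h) p =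
      Λ.apply f (Λ.apply g h) p +
      (g p * Λ.apply f (dirDeriv X h) p + dirDeriv X h p * Λ.apply f g p) -
      (h p * Λ.apply f (dirDeriv X g) p + dirDeriv X g p * Λ.apply f h p) +
      f p * (dirDeriv X (Λ.apply g h) p + g p * dirDeriv X (dirDeriv X h) p -
        h p * dirDeriv X (dirDeriv X g) p) -
      (Λ.apply g h p + g p * dirDeriv X h p - h p * dirDeriv X g p) * dirDeriv X f p := by
  change Λ.apply f _ p + f p * dirDeriv X _ p - jacobiBracket Λ X g h p * _ = _
  rw [← Λ.dirDeriv_sharpDiff f, dirDeriv_jacobiBracket _ hX hg hh,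
    dirDeriv_jacobiBracket _ hX hg hh]
  simp only [Λ.dirDeriv_sharpDiff, jacobiBracket]
  ring

open BivectorField in
theorem jacobiator_eq (hX : ContMDiff I I.tangent ∞ (T% X)) (hf : ContMDiff I 𝓘(ℝ, ℝ) ∞ f)
    (hg : ContMDiff I 𝓘(ℝ, ℝ) ∞ g) (hh : ContMDiff I 𝓘(ℝ, ℝ) ∞ h) (p : N) :
    jacobiBracket Λ X f (jacobiBracket Λ X g h) p + jacobiBracket Λ X g (jacobiBracket Λ X h f) p +
        jacobiBracket Λ X h (jacobiBracket Λ X f g) p =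
      2⁻¹ * (Λ.schoutenSelf f g h p + 2 * wedgeVector X Λ f g h p) +
        (f p * schoutenVector X Λ g h p + g p * schoutenVector X Λ h f p +
          h p * schoutenVector X Λ f g p) := by
  rw [jacobiBracket_jacobiBracket hX f hg hh, jacobiBracket_jacobiBracket hX g hh hf,
    jacobiBracket_jacobiBracket hX h hf hg]
  simp only [schoutenSelf, wedgeVector, schoutenVector, Λ.apply_swap (Λ.apply _ _) _,
    Λ.apply_swap (dirDeriv X _) _, Λ.apply_swap g f, Λ.apply_swap h g, Λ.apply_swap f h]
  ring

open BivectorField in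
theorem jacobiator_one_eq (hX : ContMDiff I I.tangent ∞ (T% X)) (hf : ContMDiff I 𝓘(ℝ, ℝ) ∞ f)
    (hg : ContMDiff I 𝓘(ℝ, ℝ) ∞ g) (p : N) :
    jacobiBracket Λ X (fun _ => 1) (jacobiBracket Λ X f g) p +
        jacobiBracket Λ X f (jacobiBracket Λ X g fun _ => 1) p +
        jacobiBracket Λ X g (jacobiBracket Λ X (fun _ => 1) f) p =
      schoutenVector X Λ f g p := by
  rw [jacobiator_eq hX contMDiff_const hf hg]
  simp only [schoutenSelf, wedgeVector, schoutenVector, apply_fun_const, const_apply_fun,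
    dirDeriv_fun_const]
  ring

end Jacobiator

namespace BivectorField

section Tensoriality

variable [FiniteDimensional ℝ E] [IsManifold I ∞ N] {Λ : BivectorField I N}
  {X : ∀ p : N, TangentSpace I p} {f f' g g' h h' : N → ℝ} {p : N}
  {c : Module.Dual ℝ E → N → ℝ}

theorem contMDiffAt_sharpDiff (hc : IsCoordFamily I c p) (hf : ContMDiff I 𝓘(ℝ, ℝ) ∞ f) :
    ContMDiffAt I I.tangent ∞ (T% (Λ.sharpDiff f)) p :=
  hc.contMDiffAt_vectorField fun ℓ => by
    rw [Λ.dirDeriv_sharpDiff]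
    exact (Λ.contMDiff_apply hf (hc.contMDiff ℓ)).contMDiffAt

theorem schoutenVector_eq_mvfderiv (hc : IsCoordFamily I c p)
    (hX : MDifferentiableAt I I.tangent (T% X) p)
    (hf : ContMDiff I 𝓘(ℝ, ℝ) ∞ f) (hg : ContMDiff I 𝓘(ℝ, ℝ) ∞ g) :
    schoutenVector X Λ f g p = mvfderiv I g p
      (VectorField.mlieBracket I X (Λ.sharpDiff f) p - Λ.sharpDiff (dirDeriv X f) p) := by
  have := FiniteDimensional.complete ℝ E
  rw [map_sub, ← dirDeriv_dirDeriv_sub_swap hX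
    ((contMDiffAt_sharpDiff hc hf).mdifferentiableAt (by simp))
    (hg.contMDiffAt.of_le ENat.LEInfty.out)]
  change _ = _ - dirDeriv (Λ.sharpDiff (dirDeriv X f)) g p
  simp only [schoutenVector, Λ.dirDeriv_sharpDiff]
  ring

theorem schoutenVector_congr (hc : IsCoordFamily I c p)
    (hX : MDifferentiableAt I I.tangent (T% X) p) (hf : ContMDiff I 𝓘(ℝ, ℝ) ∞ f)
    (hf' : ContMDiff I 𝓘(ℝ, ℝ) ∞ f')
    (hg : ContMDiff I 𝓘(ℝ, ℝ) ∞ g) (hg' : ContMDiff I 𝓘(ℝ, ℝ) ∞ g')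
    (hff' : mvfderiv I f p = mvfderiv I f' p) (hgg' : mvfderiv I g p = mvfderiv I g' p) :
    schoutenVector X Λ f g p = schoutenVector X Λ f' g' p := by
  rw [schoutenVector_eq_mvfderiv hc hX hf hg, hgg', ← schoutenVector_eq_mvfderiv hc hX hf hg',
    schoutenVector_swap, schoutenVector_eq_mvfderiv hc hX hg' hf, hff',
    ← schoutenVector_eq_mvfderiv hc hX hg' hf', ← schoutenVector_swap]

theorem schoutenSelf_eq_mvfderiv (hc : IsCoordFamily I c p) (hf : ContMDiff I 𝓘(ℝ, ℝ) ∞ f)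
    (hg : ContMDiff I 𝓘(ℝ, ℝ) ∞ g) (hh : ContMDiff I 𝓘(ℝ, ℝ) ∞ h) :
    Λ.schoutenSelf f g h p = -2 * mvfderiv I f p (Λ.sharpDiff (Λ.apply g h) p -
      VectorField.mlieBracket I (Λ.sharpDiff g) (Λ.sharpDiff h) p) := by
  have := FiniteDimensional.complete ℝ E
  rw [map_sub, ← dirDeriv_dirDeriv_sub_swap
    ((contMDiffAt_sharpDiff hc hg).mdifferentiableAt (by simp))
    ((contMDiffAt_sharpDiff hc hh).mdifferentiableAt (by simp))
    (hf.contMDiffAt.of_le ENat.LEInfty.out)]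
  change _ = -2 * (dirDeriv (Λ.sharpDiff (Λ.apply g h)) f p - _)
  simp only [schoutenSelf, Λ.dirDeriv_sharpDiff, Λ.apply_swap_fun f g, Λ.apply_swap _ h,
    Λ.apply_swap _ g, ← Λ.dirDeriv_sharpDiff h (fun _ => - _), dirDeriv_fun_neg]
  ring

theorem schoutenSelf_congr_left (hc : IsCoordFamily I c p) (hf : ContMDiff I 𝓘(ℝ, ℝ) ∞ f)
    (hf' : ContMDiff I 𝓘(ℝ, ℝ) ∞ f') (hg : ContMDiff I 𝓘(ℝ, ℝ) ∞ g)
    (hh : ContMDiff I 𝓘(ℝ, ℝ) ∞ h) (hff' : mvfderiv I f p = mvfderiv I f' p) :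
    Λ.schoutenSelf f g h p = Λ.schoutenSelf f' g h p := by
  rw [schoutenSelf_eq_mvfderiv hc hf hg hh, hff', ← schoutenSelf_eq_mvfderiv hc hf' hg hh]

theorem schoutenSelf_congr (hc : IsCoordFamily I c p) (hf : ContMDiff I 𝓘(ℝ, ℝ) ∞ f)
    (hf' : ContMDiff I 𝓘(ℝ, ℝ) ∞ f') (hg : ContMDiff I 𝓘(ℝ, ℝ) ∞ g)
    (hg' : ContMDiff I 𝓘(ℝ, ℝ) ∞ g') (hh : ContMDiff I 𝓘(ℝ, ℝ) ∞ h)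
    (hh' : ContMDiff I 𝓘(ℝ, ℝ) ∞ h') (hff' : mvfderiv I f p = mvfderiv I f' p)
    (hgg' : mvfderiv I g p = mvfderiv I g' p) (hhh' : mvfderiv I h p = mvfderiv I h' p) :
    Λ.schoutenSelf f g h p = Λ.schoutenSelf f' g' h' p := by
  rw [schoutenSelf_congr_left hc hf hf' hg hh hff', schoutenSelf_rotate,
    schoutenSelf_congr_left hc hg hg' hh hf' hgg', schoutenSelf_rotate,
    schoutenSelf_congr_left hc hh hh' hf' hg' hhh', schoutenSelf_rotate]

end Tensoriality

end BivectorField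

end Bivector

section Bump

variable {E : Type*} [NormedAddCommGroup E] [NormedSpace ℝ E] [FiniteDimensional ℝ E]
  {H : Type*} [TopologicalSpace H] {I : ModelWithCorners ℝ E H}
  {M : Type*} [TopologicalSpace M] [ChartedSpace H M] [T2Space M] {x₀ : M}

theorem exists_smoothBumpFunction_tsupport_subset {U : Set M} (hU : U ∈ 𝓝 x₀) :
    ∃ χ : SmoothBumpFunction I x₀, tsupport χ ⊆ U :=
  let ⟨χ, _, hχ⟩ := (SmoothBumpFunction.nhds_basis_tsupport x₀).mem_iff.1 hU
  ⟨χ, hχ⟩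

variable [IsManifold I ∞ M]

/-- The coordinate `ℓ` of the preferred chart at `x₀`, cut off by the bump function `χ`. -/
def bumpCoord (χ : SmoothBumpFunction I x₀) (ℓ : Module.Dual ℝ E) : C^∞⟮I, M; 𝓘(ℝ, ℝ), ℝ⟯ where
  val x := χ x * ℓ (extChartAt I x₀ x)
  property := χ.contMDiff_smul
    (ℓ.toContinuousLinearMap.contDiff.contMDiff.comp_contMDiffOn contMDiffOn_extChartAt)

theorem isCoordFamily_bumpCoord (χ : SmoothBumpFunction I x₀) :
    IsCoordFamily I (fun ℓ => bumpCoord χ ℓ) x₀ where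
  contMDiff ℓ := (bumpCoord χ ℓ).contMDiff
  eventuallyEq ℓ := by
    filter_upwards [χ.eventuallyEq_one] with x hx
    exact (congrArg (· * _) hx).trans (one_mul _)

theorem exists_isCoordFamily (x₀ : M) :
    ∃ c : Module.Dual ℝ E → M → ℝ, IsCoordFamily I c x₀ :=
  let ⟨χ⟩ : Nonempty (SmoothBumpFunction I x₀) := inferInstance
  ⟨_, isCoordFamily_bumpCoord χ⟩

end Bump

section VectorBundle

variable {E : Type*} [NormedAddCommGroup E] [NormedSpace ℝ E]
  {H : Type*} [TopologicalSpace H] {I : ModelWithCorners ℝ E H}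
  {M : Type*} [TopologicalSpace M] [ChartedSpace H M]
  {F : Type*} [NormedAddCommGroup F] [NormedSpace ℝ F]
  {W : M → Type*} [TopologicalSpace (TotalSpace F W)] [∀ x, TopologicalSpace (W x)]
  [∀ x, AddCommGroup (W x)] [∀ x, Module ℝ (W x)] [FiberBundle F W]

theorem eq_sum_coord_smul_symmL {e : Trivialization F (π F W)} [e.IsLinear ℝ] {x : M}
    (hx : x ∈ e.baseSet) {ι : Type*} [Fintype ι] (b : Module.Basis ι ℝ F) (w : W x) :
    w = ∑ i, b.coord i (e ⟨x, w⟩).2 • e.symmL ℝ x (b i) := by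
  simp only [← map_smul, ← map_sum, Module.Basis.coord_apply, b.sum_repr]
  rw [← e.continuousLinearMapAt_apply_of_mem ℝ hx, e.symmL_continuousLinearMapAt hx]

variable [VectorBundle ℝ F W] [FiniteDimensional ℝ E] [T2Space M] [IsManifold I ∞ M]
  [ContMDiffVectorBundle ∞ F W I]

section Cutoff

variable {x₀ : M} {χ : SmoothBumpFunction I x₀}

/-- The section of `W` which is `χ u` in the preferred trivialization at `x₀`, for a bump function
`χ` supported in its domain, extended by zero. -/
def cutoffSection (hχ : tsupport χ ⊆ (trivializationAt F W x₀).baseSet) (u : M → F)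
    (hu : ∀ x ∈ tsupport χ, ContMDiffAt I 𝓘(ℝ, F) ∞ u x) : Cₛ^∞⟮I; F, W⟯ where
  toFun x := χ x • (trivializationAt F W x₀).symmL ℝ x (u x)
  contMDiff_toFun x := by
    by_cases hx : x ∈ tsupport χ
    · rw [(trivializationAt F W x₀).contMDiffAt_section_iff (hχ hx)]
      refine (χ.contMDiffAt.smul (hu x hx)).congr_of_eventuallyEq ?_
      filter_upwards [(trivializationAt F W x₀).open_baseSet.mem_nhds (hχ hx)] with y hy
      rw [← (trivializationAt F W x₀).continuousLinearMapAt_apply_of_mem ℝ hy, map_smul,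
        (trivializationAt F W x₀).continuousLinearMapAt_symmL hy]
      rfl
    · refine (contMDiff_zeroSection ℝ W).contMDiffAt.congr_of_eventuallyEq ?_
      filter_upwards [(isClosed_tsupport χ).isOpen_compl.mem_nhds hx] with y hy
      rw [image_eq_zero_of_notMem_tsupport hy, zero_smul]
      rfl

theorem cutoffSection_apply (hχ : tsupport χ ⊆ (trivializationAt F W x₀).baseSet) (u : M → F)
    (hu : ∀ x ∈ tsupport χ, ContMDiffAt I 𝓘(ℝ, F) ∞ u x) (x : M) :
    cutoffSection hχ u hu x = χ x • (trivializationAt F W x₀).symmL ℝ x (u x) := rfl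

end Cutoff

theorem exists_contMDiffSection_eq (x : M) (w : W x) : ∃ s : Cₛ^∞⟮I; F, W⟯, s x = w := by
  obtain ⟨χ, hχ⟩ := exists_smoothBumpFunction_tsupport_subset (I := I)
    ((trivializationAt F W x).open_baseSet.mem_nhds (mem_baseSet_trivializationAt F W x))
  refine ⟨cutoffSection hχ (fun _ => (trivializationAt F W x).continuousLinearMapAt ℝ x w)
    fun _ _ => contMDiffAt_const, ?_⟩
  rw [cutoffSection_apply, χ.eq_one, one_smul,
    Trivialization.symmL_continuousLinearMapAt _ (mem_baseSet_trivializationAt F W x)]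

variable [FiniteDimensional ℝ F]

section Descent

variable {T : Type*} [AddCommGroup T] [Module ℝ T] {x : M} {D : Cₛ^∞⟮I; F, W⟯ →ₗ[ℝ] T}

/-- Cut off by the square of a bump function, a section is a combination of finitely many sections,
with coefficients vanishing wherever the section does. -/
theorem map_section_eq_zero_of_apply_eq_zero
    (hD : ∀ (f : C^∞⟮I, M; 𝓘(ℝ, ℝ), ℝ⟯) s, D (f • s) = f x • D s)
    {s : Cₛ^∞⟮I; F, W⟯} (hs : s x = 0) : D s = 0 := by
  let e := trivializationAt F W x
  have hx : x ∈ e.baseSet := mem_baseSet_trivializationAt F W x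
  obtain ⟨χ, hχ⟩ := exists_smoothBumpFunction_tsupport_subset (I := I)
    (e.open_baseSet.mem_nhds hx)
  let b := Module.finBasis ℝ F
  let u (i) : C^∞⟮I, M; 𝓘(ℝ, ℝ), ℝ⟯ := ⟨fun y => χ y * b.coord i (e ⟨y, s y⟩).2,
    contMDiff_of_tsupport fun y hy => χ.contMDiffAt.mul <|
      ((b.coord i).toContinuousLinearMap.contDiff.contMDiff _).comp y <|
        (e.contMDiffAt_section_iff (hχ (closure_mono (Function.support_mul_subset_left _ _) hy))).1
          s.contMDiff.contMDiffAt⟩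
  let t (i) : Cₛ^∞⟮I; F, W⟯ := cutoffSection hχ (fun _ => b i) fun _ _ => contMDiffAt_const
  let χ' : C^∞⟮I, M; 𝓘(ℝ, ℝ), ℝ⟯ := ⟨χ, χ.contMDiff⟩
  have hsum : χ' • χ' • s = ∑ i, u i • t i := by
    ext y
    have ht : (∑ i, u i • t i) y = ∑ i, (χ y * b.coord i (e ⟨y, s y⟩).2) •
        χ y • e.symmL ℝ y (b i) :=
      (congrFun (map_sum (ContMDiffSection.coeAddHom I F ∞ W) _ _) y).trans
        (Finset.sum_apply y _ _)
    rw [ht]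
    change χ y • χ y • s y = _
    by_cases hy : y ∈ e.baseSet
    · conv_lhs => rw [eq_sum_coord_smul_symmL hy b (s y)]
      simp only [Finset.smul_sum, smul_smul]
      exact Finset.sum_congr rfl fun i _ => by congr 1; ring
    · rw [image_eq_zero_of_notMem_tsupport fun h => hy (hχ h)]
      simp only [zero_smul, zero_mul, Finset.sum_const_zero]
  have hu (i) : u i x = 0 := by
    change χ x * b.coord i (e ⟨x, s x⟩).2 = 0
    rw [hs, ← e.continuousLinearMapAt_apply_of_mem ℝ hx, map_zero, map_zero, mul_zero]
  have hχ' : χ' x = 1 := χ.eq_one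
  calc D s = D (χ' • χ' • s) := by rw [hD, hD, hχ', one_smul, one_smul]
    _ = 0 := by simp only [hsum, map_sum, hD, hu, zero_smul, Finset.sum_const_zero]

theorem exists_linearMap_apply_section
    (hD : ∀ (f : C^∞⟮I, M; 𝓘(ℝ, ℝ), ℝ⟯) s, D (f • s) = f x • D s) :
    ∃ ρ : W x →ₗ[ℝ] T, ∀ s, ρ (s x) = D s := by
  let ev : Cₛ^∞⟮I; F, W⟯ →ₗ[ℝ] W x :=
    { toFun := fun s => s x, map_add' := fun _ _ => rfl, map_smul' := fun _ _ => rfl }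
  obtain ⟨σ, hσ⟩ := ev.exists_rightInverse_of_surjective
    (LinearMap.range_eq_top.2 (exists_contMDiffSection_eq x))
  refine ⟨D ∘ₗ σ, fun s => ?_⟩
  have hs : (σ (s x) - s) x = 0 := sub_eq_zero.2 (LinearMap.congr_fun hσ (s x))
  exact sub_eq_zero.1 ((map_sub D _ _).symm.trans (map_section_eq_zero_of_apply_eq_zero hD hs))

end Descent

variable {F' : Type*} [NormedAddCommGroup F'] [NormedSpace ℝ F']
  {W' : M → Type*} [TopologicalSpace (TotalSpace F' W')] [∀ x, TopologicalSpace (W' x)]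
  [∀ x, AddCommGroup (W' x)] [∀ x, Module ℝ (W' x)] [FiberBundle F' W'] [VectorBundle ℝ F' W']

theorem contMDiff_linearMap_of_section {ρ : ∀ x, W x →ₗ[ℝ] W' x}
    (hρ : ∀ s : Cₛ^∞⟮I; F, W⟯, ContMDiff I (I.prod 𝓘(ℝ, F')) ∞ (T% fun x => ρ x (s x))) :
    ContMDiff (I.prod 𝓘(ℝ, F)) (I.prod 𝓘(ℝ, F')) ∞
      fun w : TotalSpace F W => (⟨w.proj, ρ w.proj w.snd⟩ : TotalSpace F' W') := by
  intro w₀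
  let e := trivializationAt F W w₀.proj
  let e' := trivializationAt F' W' w₀.proj
  have hx : w₀.proj ∈ e.baseSet := mem_baseSet_trivializationAt F W w₀.proj
  obtain ⟨χ, hχ⟩ := exists_smoothBumpFunction_tsupport_subset (I := I)
    (e.open_baseSet.mem_nhds hx)
  let b := Module.finBasis ℝ F
  let t (i) : Cₛ^∞⟮I; F, W⟯ := cutoffSection hχ (fun _ => b i) fun _ _ => contMDiffAt_const
  have hsum : ∀ᶠ x in 𝓝 w₀.proj, ∀ w : W x,
      (e' ⟨x, ρ x w⟩).2 = ∑ i, b.coord i (e ⟨x, w⟩).2 • (e' ⟨x, ρ x (t i x)⟩).2 := by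
    filter_upwards [e.open_baseSet.mem_nhds hx, e'.open_baseSet.mem_nhds
      (mem_baseSet_trivializationAt F' W' w₀.proj), χ.eventuallyEq_one] with x hxe hxe' hχx w
    have ht (i) : t i x = e.symmL ℝ x (b i) := by
      change χ x • e.symmL ℝ x (b i) = _
      rw [hχx, Pi.one_apply, one_smul]
    conv_lhs => rw [eq_sum_coord_smul_symmL hxe b w]
    simp only [← e'.continuousLinearMapAt_apply_of_mem ℝ hxe', ht, map_smul, map_sum]
  refine contMDiffAt_totalSpace.2 ⟨contMDiffAt_proj W, ?_⟩
  refine ContMDiffAt.congr_of_eventuallyEq (ContMDiffAt.sum (t := Finset.univ) fun i _ => ?_)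
    (((FiberBundle.continuous_proj F W).continuousAt.eventually hsum).mono fun w hw => hw w.snd)
  have he : ContMDiffAt (I.prod 𝓘(ℝ, F)) 𝓘(ℝ, F) ∞ (fun w : TotalSpace F W => (e w).2) w₀ :=
    (contMDiffAt_totalSpace.1 contMDiffAt_id).2
  exact (((b.coord i).toContinuousLinearMap.contDiff.contMDiff _).comp w₀ he).smul
    (ContMDiffAt.comp (g := fun x => (e' ⟨x, ρ x (t i x)⟩).2) w₀
      ((contMDiffAt_section _).1 (hρ (t i) _)) (contMDiffAt_proj W))

end VectorBundle

section AffineFunctions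

variable {E : Type*} [NormedAddCommGroup E] [NormedSpace ℝ E]
  {H : Type*} [TopologicalSpace H] {I : ModelWithCorners ℝ E H}
  {M : Type*} [TopologicalSpace M] [ChartedSpace H M]
  {F : Type*} [NormedAddCommGroup F] [NormedSpace ℝ F]
  {V : M → Type*} [∀ x, AddCommGroup (V x)] [∀ x, Module ℝ (V x)]
  {A : M → Type*} [∀ x, AddTorsor (V x) (A x)] [∀ x, TopologicalSpace (A x)]
  [TopologicalSpace (TotalSpace F A)] [FiberBundle F A]

theorem mvfderiv_comp_proj {f : M → ℝ} (hf : ContMDiff I 𝓘(ℝ, ℝ) ∞ f)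
    (p : TotalSpace F A) (v : TangentSpace (I.prod 𝓘(ℝ, F)) p) :
    mvfderiv (I.prod 𝓘(ℝ, F)) (fun q : TotalSpace F A => f q.proj) p v =
      mvfderiv I f p.proj (mfderiv (I.prod 𝓘(ℝ, F)) I (π F A) p v) :=
  mvfderiv_comp_apply p (hf.mdifferentiableAt (by simp))
    ((contMDiff_proj A (n := ∞)).mdifferentiableAt (by simp)) v

section Smooth

variable [SmoothFiberBundle I F A]

theorem contMDiffAt_trivialization_snd (e : Trivialization F (π F A)) [MemTrivializationAtlas e]
    {p : TotalSpace F A} (hp : p.proj ∈ e.baseSet) :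
    ContMDiffAt (I.prod 𝓘(ℝ, F)) 𝓘(ℝ, F) ∞ (fun q : TotalSpace F A => (e q).2) p := by
  let e₁ := trivializationAt F A p.proj
  have hp₁ : p.proj ∈ e₁.baseSet := mem_baseSet_trivializationAt F A p.proj
  have hsnd : ContMDiffAt (I.prod 𝓘(ℝ, F)) 𝓘(ℝ, F) ∞
      (fun q : TotalSpace F A => (e₁ q).2) p :=
    (contMDiffAt_totalSpace.1 (contMDiffAt_id (I := I.prod 𝓘(ℝ, F)) (x := p))).2
  have hpair : ContMDiffAt (I.prod 𝓘(ℝ, F)) (I.prod 𝓘(ℝ, F)) ∞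
      (fun q : TotalSpace F A => ((q.proj, (e₁ q).2) : M × F)) p :=
    (contMDiffAt_proj A).prodMk hsnd
  have htrans := SmoothFiberBundle.contMDiffOn_symm_trans (I := I) e₁ e
  have hopen : IsOpen (e₁.target ∩ e.target) := e₁.open_target.inter e.open_target
  have hcomp := (htrans.contMDiffAt (hopen.mem_nhds
    (x := (p.proj, (e₁ p).2)) ⟨e₁.mem_target.2 hp₁, e.mem_target.2 hp⟩)).comp p hpair
  refine (contMDiffAt_snd.comp p hcomp).congr_of_eventuallyEq ?_
  have hs : e₁.source ∈ 𝓝 p := e₁.open_source.mem_nhds (e₁.mem_source.2 hp₁)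
  filter_upwards [hs] with q hq
  have : ((q.proj, (e₁ q).2) : M × F) = e₁ q := Prod.ext (e₁.coe_fst hq).symm rfl
  change (e q).2 = (e (e₁.toOpenPartialHomeomorph.symm (q.proj, (e₁ q).2))).2
  rw [this]
  exact congrArg (fun r => (e r).2) (e₁.toOpenPartialHomeomorph.left_inv hq).symm

theorem contMDiffAt_trivialization_symm (e : Trivialization F (π F A)) [MemTrivializationAtlas e]
    {z : M × F} (hz : z.1 ∈ e.baseSet) :
    ContMDiffAt (I.prod 𝓘(ℝ, F)) (I.prod 𝓘(ℝ, F)) ∞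
      e.toOpenPartialHomeomorph.symm z := by
  have hzt : z ∈ e.target := e.mem_target.2 hz
  have hproj : ∀ᶠ w in 𝓝 z, (e.toOpenPartialHomeomorph.symm w).proj = w.1 := by
    filter_upwards [e.open_target.mem_nhds hzt] with w hw using e.proj_symm_apply hw
  rw [contMDiffAt_totalSpace]
  refine ⟨contMDiffAt_fst.congr_of_eventuallyEq hproj, ?_⟩
  have htrans := SmoothFiberBundle.contMDiffOn_symm_trans (I := I) e
    (trivializationAt F A (e.toOpenPartialHomeomorph.symm z).proj)
  refine contMDiffAt_snd.comp z (htrans.contMDiffAt ?_)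
  refine (e.open_target.inter (trivializationAt F A
    (e.toOpenPartialHomeomorph.symm z).proj).open_target).mem_nhds ⟨hzt, ?_⟩
  rw [Trivialization.mem_target, ← e.proj_symm_apply hzt]
  exact mem_baseSet_trivializationAt F A _

theorem contMDiffAt_comp_trivialization_symm (e : Trivialization F (π F A))
    [MemTrivializationAtlas e] {a : TotalSpace F A → ℝ}
    (ha : ContMDiff (I.prod 𝓘(ℝ, F)) 𝓘(ℝ, ℝ) ∞ a) (v : F) {x : M} (hx : x ∈ e.baseSet) :
    ContMDiffAt I 𝓘(ℝ, ℝ) ∞ (fun y => a (e.toOpenPartialHomeomorph.symm (y, v))) x :=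
  (ha _).comp x (f := fun y => e.toOpenPartialHomeomorph.symm (y, v))
    ((contMDiffAt_trivialization_symm e (z := (x, v)) hx).comp x (f := fun y => (y, v))
      (contMDiffAt_id.prodMk contMDiffAt_const))

end Smooth

namespace IsAffineFunction

theorem contMDiff {a : TotalSpace F A → ℝ} (ha : IsAffineFunction I F A a) :
    ContMDiff (I.prod 𝓘(ℝ, F)) 𝓘(ℝ, ℝ) ∞ a := ha.1

theorem mdifferentiableAt {a : TotalSpace F A → ℝ} (ha : IsAffineFunction I F A a)
    (p : TotalSpace F A) : MDifferentiableAt (I.prod 𝓘(ℝ, F)) 𝓘(ℝ, ℝ) a p :=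
  ha.1.mdifferentiableAt (by simp)

theorem add {a b : TotalSpace F A → ℝ} (ha : IsAffineFunction I F A a)
    (hb : IsAffineFunction I F A b) :
    IsAffineFunction I F A (fun p => a p + b p) := by
  refine ⟨ha.1.add hb.1, fun x => ?_⟩
  obtain ⟨φ, hφ⟩ := ha.2 x
  obtain ⟨ψ, hψ⟩ := hb.2 x
  exact ⟨φ + ψ, fun y => by simp [hφ, hψ]⟩

theorem basic_mul {f : M → ℝ} (hf : ContMDiff I 𝓘(ℝ, ℝ) ∞ f) {a : TotalSpace F A → ℝ}
    (ha : IsAffineFunction I F A a) :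
    IsAffineFunction I F A (fun p => f p.proj * a p) := by
  refine ⟨(hf.comp (contMDiff_proj A)).mul ha.1, fun x => ?_⟩
  obtain ⟨φ, hφ⟩ := ha.2 x
  exact ⟨f x • φ, fun y => by simp [hφ]⟩

theorem const_mul (c : ℝ) {a : TotalSpace F A → ℝ} (ha : IsAffineFunction I F A a) :
    IsAffineFunction I F A (fun p => c * a p) :=
  ha.basic_mul (f := fun _ => c) contMDiff_const

theorem sub {a b : TotalSpace F A → ℝ} (ha : IsAffineFunction I F A a)
    (hb : IsAffineFunction I F A b) :
    IsAffineFunction I F A (fun p => a p - b p) := by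
  have := ha.add (hb.const_mul (-1))
  simpa only [neg_mul, one_mul, ← sub_eq_add_neg] using this

theorem basic {f : M → ℝ} (hf : ContMDiff I 𝓘(ℝ, ℝ) ∞ f) :
    IsAffineFunction I F A (fun p => f p.proj) :=
  ⟨hf.comp (contMDiff_proj A), fun x => ⟨AffineMap.const ℝ (A x) (f x), fun _ => rfl⟩⟩

theorem const (c : ℝ) : IsAffineFunction I F A (fun _ => c) :=
  basic (f := fun _ => c) contMDiff_const

theorem eq_of_mul {c : TotalSpace F A → ℝ} (hc : IsAffineFunction I F A c)
    (h : ∀ b, IsAffineFunction I F A b → IsAffineFunction I F A (fun p => b p * c p))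
    {x : M} (y y' : A x) : c ⟨x, y⟩ = c ⟨x, y'⟩ := by
  obtain ⟨φ, hφ⟩ := hc.2 x
  obtain ⟨ψ, hψ⟩ := (h c hc).2 x
  have hsq : ∀ z, ψ z = φ z * φ z := fun z => by rw [← hψ, ← hφ]
  have hy := hsq y
  have hy' := hsq y'
  have hline := hsq (AffineMap.lineMap y y' (2 : ℝ))
  simp only [AffineMap.apply_lineMap, AffineMap.lineMap_apply_ring, hy, hy'] at hline
  rw [hφ, hφ]
  have : (φ y - φ y') ^ 2 = 0 := by linarith
  exact sub_eq_zero.1 (pow_eq_zero_iff (two_ne_zero) |>.1 this)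

variable [SmoothFiberBundle I F A]

theorem exists_basic {c : TotalSpace F A → ℝ}
    (hc : ContMDiff (I.prod 𝓘(ℝ, F)) 𝓘(ℝ, ℝ) ∞ c)
    (h : ∀ (x : M) (y y' : A x), c ⟨x, y⟩ = c ⟨x, y'⟩) :
    ∃ f : M → ℝ, ContMDiff I 𝓘(ℝ, ℝ) ∞ f ∧ ∀ p, c p = f p.proj := by
  have h' : ∀ p q : TotalSpace F A, p.proj = q.proj → c p = c q := by
    rintro ⟨x, y⟩ ⟨x', y'⟩ (rfl : x = x')
    exact h x y y'
  have hproj : ∀ x x' : M, x' ∈ (trivializationAt F A x).baseSet →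
      ((trivializationAt F A x).toOpenPartialHomeomorph.symm (x', 0)).proj = x' :=
    fun x x' hx => (trivializationAt F A x).proj_symm_apply
      ((trivializationAt F A x).mem_target.2 hx)
  refine ⟨fun x => c ((trivializationAt F A x).toOpenPartialHomeomorph.symm (x, 0)), ?_, ?_⟩
  · intro x₀
    have hx₀ := mem_baseSet_trivializationAt F A x₀
    refine (contMDiffAt_comp_trivialization_symm (trivializationAt F A x₀) hc 0
      hx₀).congr_of_eventuallyEq ?_
    filter_upwards [(trivializationAt F A x₀).open_baseSet.mem_nhds hx₀] with x hx
    refine h' _ _ ?_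
    rw [hproj x x (mem_baseSet_trivializationAt F A x), hproj x₀ x hx]
  · intro p
    refine h' _ _ ?_
    rw [hproj _ _ (mem_baseSet_trivializationAt F A p.proj)]

end IsAffineFunction

end AffineFunctions

section Sections

variable {E : Type*} [NormedAddCommGroup E] [NormedSpace ℝ E]
  {H : Type*} [TopologicalSpace H] {I : ModelWithCorners ℝ E H}
  {M : Type*} [TopologicalSpace M] [ChartedSpace H M]
  {F : Type*} [NormedAddCommGroup F] [NormedSpace ℝ F]
  {V : M → Type*} [∀ x, AddCommGroup (V x)] [∀ x, Module ℝ (V x)]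
  {A : M → Type*} [∀ x, AddTorsor (V x) (A x)] [∀ x, TopologicalSpace (A x)]
  [TopologicalSpace (TotalSpace F A)] [FiberBundle F A]

namespace AffDual

/-- The restriction of an affine function to a fibre, as an element of the vector dual. -/
def fiberMap {a : TotalSpace F A → ℝ} (ha : IsAffineFunction I F A a) (x : M) : AffDual A x :=
  (ha.2 x).choose

theorem fiberMap_apply {a : TotalSpace F A → ℝ} (ha : IsAffineFunction I F A a) (x : M) (y : A x) :
    (fiberMap ha x).toAffineMap y = a ⟨x, y⟩ :=
  ((ha.2 x).choose_spec y).symm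

theorem contDiff_eval : ContDiff ℝ ∞ fun p : (F →ᴬ[ℝ] ℝ) × F => p.1 p.2 := by
  let D := ContinuousAffineMap.decompLinearIsometryEquiv ℝ ℝ F ℝ
  have hD : ContDiff ℝ ∞ fun p : (F →ᴬ[ℝ] ℝ) × F => D p.1 := D.contDiff.comp contDiff_fst
  have heval (p : (F →ᴬ[ℝ] ℝ) × F) : p.1 p.2 = (D p.1).1 + (D p.1).2 p.2 :=
    (congrFun (AffineMap.decomp (p.1 : F →ᵃ[ℝ] ℝ)) p.2).trans (add_comm _ _)
  simp only [heval]
  exact hD.fst.add (hD.snd.clm_apply contDiff_snd)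

variable [FiniteDimensional ℝ F]

/-- The restriction of a linear form on `E × F` to the slice `{e} × F`. -/
def slice (e : E) : Module.Dual ℝ (E × F) →ₗ[ℝ] F →ᴬ[ℝ] ℝ where
  toFun ℓ := ℓ (e, 0) • ContinuousAffineMap.const ℝ F (1 : ℝ)
    + (ℓ ∘ₗ LinearMap.inr ℝ E F).toContinuousLinearMap.toContinuousAffineMap
  map_add' ℓ ℓ' := by
    ext v
    change (ℓ (e, 0) + ℓ' (e, 0)) * 1 + (ℓ (0, v) + ℓ' (0, v))
      = ℓ (e, 0) * 1 + ℓ (0, v) + (ℓ' (e, 0) * 1 + ℓ' (0, v))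
    ring
  map_smul' c ℓ := by
    ext v
    change c * ℓ (e, 0) * 1 + c * ℓ (0, v) = c * (ℓ (e, 0) * 1 + ℓ (0, v))
    ring

theorem slice_apply (e : E) (ℓ : Module.Dual ℝ (E × F)) (v : F) : slice e ℓ v = ℓ (e, v) := by
  have hsum : ℓ (e, v) = ℓ (e, 0) + ℓ (0, v) := by
    rw [← map_add, Prod.mk_add_mk, add_zero, zero_add]
  rw [hsum]
  exact congrArg (· + ℓ (0, v)) (mul_one _)

theorem contDiff_slice [FiniteDimensional ℝ E] (ℓ : Module.Dual ℝ (E × F)) :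
    ContDiff ℝ ∞ fun e => slice e ℓ :=
  ((ℓ ∘ₗ LinearMap.inl ℝ E F).toContinuousLinearMap.contDiff.smul contDiff_const).add
    contDiff_const

variable [AffineBundle F A]

theorem toAffineMap_eq_trivializationAt {x₀ x : M} (hx : x ∈ (trivializationAt F A x₀).baseSet)
    (α : AffDual A x) (y : A x) :
    α.toAffineMap y = (trivializationAt (F →ᴬ[ℝ] ℝ) (AffDual A) x₀ ⟨x, α⟩).2
      (trivializationAt F A x₀ ⟨x, y⟩).2 := by
  rw [trivializationAt_apply F x₀ hx, fiberEquiv_apply, ← trivEquiv_apply _ x hx,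
    AffineEquiv.symm_apply_apply]

theorem toFunction_injective :
    Function.Injective (toFunction : Cₛ^∞⟮I; F →ᴬ[ℝ] ℝ, AffDual A⟯ → _) := fun _ _ h =>
  ContMDiffSection.ext fun x => AffineMap.ext fun y => congrFun h ⟨x, y⟩

theorem toFunction_smul (f : C^∞⟮I, M; 𝓘(ℝ, ℝ), ℝ⟯) (s : Cₛ^∞⟮I; F →ᴬ[ℝ] ℝ, AffDual A⟯) :
    toFunction (f • s) = fun p => f p.proj * toFunction s p := rfl

variable [SmoothFiberBundle I F A]

theorem isAffineFunction_toFunction (s : Cₛ^∞⟮I; F →ᴬ[ℝ] ℝ, AffDual A⟯) :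
    IsAffineFunction I F A (toFunction s) := by
  refine ⟨fun p₀ => ?_, fun x => ⟨(s x).toAffineMap, fun _ => rfl⟩⟩
  have hp₀ := mem_baseSet_trivializationAt F A p₀.proj
  have hs : ContMDiffAt (I.prod 𝓘(ℝ, F)) 𝓘(ℝ, F →ᴬ[ℝ] ℝ) ∞ (fun p : TotalSpace F A =>
      (trivializationAt (F →ᴬ[ℝ] ℝ) (AffDual A) p₀.proj ⟨p.proj, s p.proj⟩).2) p₀ :=
    ((contMDiffAt_section p₀.proj).1 (s.contMDiff p₀.proj)).comp p₀ (contMDiffAt_proj A)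
  refine ((contDiff_eval.contMDiff _).comp p₀ (hs.prodMk_space
    (contMDiffAt_trivialization_snd _ hp₀))).congr_of_eventuallyEq ?_
  filter_upwards [(FiberBundle.continuous_proj F A).continuousAt.eventually
    ((trivializationAt F A p₀.proj).open_baseSet.mem_nhds hp₀)] with p hp
  exact toAffineMap_eq_trivializationAt hp (s p.proj) p.snd

/-- The section of `A⁺` corresponding to an affine function on `A`, inverse to `toFunction`. -/
def ofFunction (a : TotalSpace F A → ℝ) (ha : IsAffineFunction I F A a) :
    Cₛ^∞⟮I; F →ᴬ[ℝ] ℝ, AffDual A⟯ where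
  toFun x := fiberMap ha x
  contMDiff_toFun := by
    intro x₀
    have hx₀ := (trivializationAt F A x₀).open_baseSet.mem_nhds
      (mem_baseSet_trivializationAt F A x₀)
    rw [contMDiffAt_section]
    refine ContMDiffOn.contMDiffAt (s := (trivializationAt F A x₀).baseSet)
      (contMDiffOn_of_separating I (fun v : F => evalLinear v)
        (fun g hg => ContinuousAffineMap.ext fun v => hg v) fun v x hx => ?_) hx₀
    refine ((contMDiffAt_comp_trivialization_symm (trivializationAt F A x₀) ha.1 v
      hx).congr_of_eventuallyEq ?_).contMDiffWithinAt
    filter_upwards [(trivializationAt F A x₀).open_baseSet.mem_nhds hx] with y hy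
    rw [trivializationAt_apply F x₀ hy, ← mk_trivEquiv_symm _ y hy]
    exact fiberMap_apply ha y _

theorem toFunction_ofFunction {a : TotalSpace F A → ℝ} (ha : IsAffineFunction I F A a) :
    toFunction (ofFunction a ha) = a :=
  funext fun p => fiberMap_apply ha p.proj p.snd

variable [FiniteDimensional ℝ E] [T2Space M] [IsManifold I ∞ M]

theorem exists_isAffineFunction_ne [Nontrivial F] (x : M) :
    ∃ a, IsAffineFunction I F A a ∧ ∃ y y' : A x, a ⟨x, y⟩ ≠ a ⟨x, y'⟩ := by
  let φ := trivEquiv (trivializationAt F A x) x (mem_baseSet_trivializationAt F A x)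
  obtain ⟨v, hv⟩ := exists_ne (0 : F)
  obtain ⟨ℓ, hℓ⟩ := SeparatingDual.exists_ne_zero (R := ℝ) hv
  obtain ⟨s, hs⟩ := exists_contMDiffSection_eq (I := I) (F := F →ᴬ[ℝ] ℝ) x
    ((fiberEquiv φ).symm ℓ.toContinuousAffineMap)
  have hsφ (w : F) : toFunction s ⟨x, φ.symm w⟩ = ℓ w := by
    rw [toFunction, hs, fiberEquiv_symm_apply, AffineEquiv.apply_symm_apply]
    rfl
  refine ⟨toFunction s, isAffineFunction_toFunction s, φ.symm v, φ.symm 0, ?_⟩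
  rwa [hsφ, hsφ, map_zero]

section AffineCoordinates

variable {x₀ : M} {χ : SmoothBumpFunction I x₀}

/-- The affine function `ℓ (x, v)`, where `x` is read in the chart at `x₀` and `v` in the preferred
trivialization of `A`, cut off by `χ`; as a section of `A⁺`. -/
def coordSection (hχ : tsupport χ ⊆ (trivializationAt F A x₀).baseSet) :
    Module.Dual ℝ (E × F) →ₗ[ℝ] Cₛ^∞⟮I; F →ᴬ[ℝ] ℝ, AffDual A⟯ where
  toFun ℓ := cutoffSection (W := AffDual A) hχ (fun x => slice (extChartAt I x₀ x) ℓ) fun x hx =>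
    (contDiff_slice ℓ).contMDiff.contMDiffAt.comp x
      (contMDiffAt_extChartAt' (χ.tsupport_subset_chartAt_source hx))
  map_add' ℓ ℓ' := by
    ext x
    change χ x • (trivializationAt _ (AffDual A) x₀).symmL ℝ x _ = χ x • _ + χ x • _
    simp only [map_add, smul_add]
  map_smul' c ℓ := by
    ext x
    change χ x • (trivializationAt _ (AffDual A) x₀).symmL ℝ x _ = c • χ x • _
    simp only [map_smul, smul_comm c]

theorem toFunction_coordSection (hχ : tsupport χ ⊆ (trivializationAt F A x₀).baseSet)
    (ℓ : Module.Dual ℝ (E × F)) (p : TotalSpace F A) : toFunction (coordSection hχ ℓ) p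
      = χ p.proj * ℓ (extChartAt I x₀ p.proj, (trivializationAt F A x₀ p).2) := by
  by_cases hp : p.proj ∈ tsupport χ
  · have hx : p.proj ∈ (trivializationAt (F →ᴬ[ℝ] ℝ) (AffDual A) x₀).baseSet := hχ hp
    change χ p.proj * ((trivializationAt (F →ᴬ[ℝ] ℝ) (AffDual A) x₀).symmL ℝ p.proj
      (slice (extChartAt I x₀ p.proj) ℓ)).toAffineMap p.snd = _
    rw [toAffineMap_eq_trivializationAt (hχ hp), Trivialization.symmL_apply,
      Trivialization.apply_mk_symm _ hx, slice_apply]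
    exact hx
  · change χ p.proj * _ = _
    rw [image_eq_zero_of_notMem_tsupport hp, zero_mul, zero_mul]

theorem isCoordFamily_coordSection (hχ : tsupport χ ⊆ (trivializationAt F A x₀).baseSet)
    (y₀ : A x₀) :
    IsCoordFamily (I.prod 𝓘(ℝ, F)) (fun ℓ => toFunction (coordSection hχ ℓ)) ⟨x₀, y₀⟩ where
  contMDiff ℓ := (isAffineFunction_toFunction _).1
  eventuallyEq ℓ := by
    have hproj := (FiberBundle.continuous_proj F A).continuousAt (x := ⟨x₀, y₀⟩)
    filter_upwards [hproj.eventually χ.eventuallyEq_one, hproj.eventually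
      ((trivializationAt F A x₀).open_baseSet.mem_nhds (mem_baseSet_trivializationAt F A x₀))]
      with p hp hbase
    rw [toFunction_coordSection, hp, Pi.one_apply, one_mul, FiberBundle.extChartAt]
    change _ = ℓ (extChartAt I x₀ (trivializationAt F A x₀ p).1, (trivializationAt F A x₀ p).2)
    rw [Trivialization.coe_fst' _ hbase]

end AffineCoordinates

end AffDual

end Sections

namespace JacobiStructure

section General

variable {E : Type*} [NormedAddCommGroup E] [NormedSpace ℝ E]
  {H : Type*} [TopologicalSpace H] {I : ModelWithCorners ℝ E H}
  {N : Type*} [TopologicalSpace N] [ChartedSpace H N] [IsManifold I ∞ N]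
  (J : JacobiStructure I N)

theorem bracket_eq_jacobiBracket : J.bracket = jacobiBracket J.bivector J.reeb := rfl

theorem bracket_swap (f g : N → ℝ) (p : N) : J.bracket f g p = - J.bracket g f p := by
  simp only [bracket, J.bivector.apply_swap f g]
  ring

theorem bracket_self (f : N → ℝ) (p : N) : J.bracket f f p = 0 :=
  self_eq_neg.1 (J.bracket_swap f f p)

variable [FiniteDimensional ℝ E]

theorem hamiltonian_eq (f : N → ℝ) (p : N) :
    J.hamiltonian f p = J.bivector.sharpDiff f p + f p • J.reeb p := rfl

theorem dirDeriv_hamiltonian (f g : N → ℝ) (p : N) :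
    dirDeriv (J.hamiltonian f) g p = J.bivector.apply f g p + f p * dirDeriv J.reeb g p := by
  rw [dirDeriv, hamiltonian_eq, map_add, map_smul, smul_eq_mul, ← J.bivector.dirDeriv_sharpDiff]
  rfl

theorem dirDeriv_hamiltonian_eq_bracket (f g : N → ℝ) (p : N) :
    dirDeriv (J.hamiltonian f) g p = J.bracket f g p + g p * dirDeriv J.reeb f p := by
  rw [dirDeriv_hamiltonian, bracket]
  ring

theorem dirDeriv_reeb_eq_neg_bracket (f : N → ℝ) :
    dirDeriv J.reeb f = fun p => - J.bracket f (fun _ => 1) p := by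
  funext p
  have h := J.dirDeriv_hamiltonian_eq_bracket f (fun _ => 1) p
  rw [dirDeriv_fun_const] at h
  linarith

variable {J} {f g h : N → ℝ} {p : N}

theorem hamiltonian_fun_add (hf : MDifferentiableAt I 𝓘(ℝ, ℝ) f p)
    (hg : MDifferentiableAt I 𝓘(ℝ, ℝ) g p) :
    J.hamiltonian (fun q => f q + g q) p = J.hamiltonian f p + J.hamiltonian g p := by
  simp only [hamiltonian, BivectorField.sharp, mvfderiv_fun_add hf hg,
    ContinuousLinearMap.toLinearMap_add, map_add, add_smul]
  abel

theorem hamiltonian_fun_mul (hf : MDifferentiableAt I 𝓘(ℝ, ℝ) f p)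
    (hg : MDifferentiableAt I 𝓘(ℝ, ℝ) g p) :
    J.hamiltonian (fun q => f q * g q) p =
      f p • J.hamiltonian g p + g p • J.bivector.sharpDiff f p := by
  simp only [hamiltonian, BivectorField.sharpDiff, BivectorField.sharp, mvfderiv_fun_mul hf hg,
    ContinuousLinearMap.toLinearMap_add, ContinuousLinearMap.toLinearMap_smul, map_add, map_smul,
    smul_add, smul_smul]
  abel

theorem bracket_fun_add (f : N → ℝ) (hg : MDifferentiableAt I 𝓘(ℝ, ℝ) g p)
    (hh : MDifferentiableAt I 𝓘(ℝ, ℝ) h p) :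
    J.bracket f (fun q => g q + h q) p = J.bracket f g p + J.bracket f h p := by
  have key := dirDeriv_fun_add (J.hamiltonian f) hg hh
  simp only [dirDeriv_hamiltonian_eq_bracket] at key
  linarith

theorem bracket_fun_mul (f : N → ℝ) (hg : MDifferentiableAt I 𝓘(ℝ, ℝ) g p)
    (hh : MDifferentiableAt I 𝓘(ℝ, ℝ) h p) :
    J.bracket f (fun q => g q * h q) p =
      g p * J.bracket f h p + dirDeriv (J.hamiltonian f) g p * h p := by
  have key := dirDeriv_fun_mul (J.hamiltonian f) hg hh
  simp only [dirDeriv_hamiltonian_eq_bracket] at key ⊢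
  linarith

theorem bracket_const_mul (f : N → ℝ) (c : ℝ) (hg : MDifferentiableAt I 𝓘(ℝ, ℝ) g p) :
    J.bracket f (fun q => c * g q) p = c * J.bracket f g p := by
  rw [bracket_fun_mul f mdifferentiableAt_const hg, dirDeriv_fun_const, zero_mul, add_zero]

theorem bracket_jacobi (hf : ContMDiff I 𝓘(ℝ, ℝ) ∞ f) (hg : ContMDiff I 𝓘(ℝ, ℝ) ∞ g)
    (hh : ContMDiff I 𝓘(ℝ, ℝ) ∞ h) (p : N) :
    J.bracket f (J.bracket g h) p + J.bracket g (J.bracket h f) p +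
      J.bracket h (J.bracket f g) p = 0 := by
  rw [bracket_eq_jacobiBracket, jacobiator_eq J.reeb.contMDiff hf hg hh,
    J.schouten_self f g h hf hg hh, J.schouten_reeb g h hg hh, J.schouten_reeb h f hh hf,
    J.schouten_reeb f g hf hg]
  ring

end General

section StronglyAffine

variable {E : Type*} [NormedAddCommGroup E] [NormedSpace ℝ E]
  {H : Type*} [TopologicalSpace H] {I : ModelWithCorners ℝ E H}
  {M : Type*} [TopologicalSpace M] [ChartedSpace H M]
  {F : Type*} [NormedAddCommGroup F] [NormedSpace ℝ F]
  {V : M → Type*} [∀ x, AddCommGroup (V x)] [∀ x, Module ℝ (V x)]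
  {A : M → Type*} [∀ x, AddTorsor (V x) (A x)] [∀ x, TopologicalSpace (A x)]
  [TopologicalSpace (TotalSpace F A)] [FiberBundle F A]
  [FiniteDimensional ℝ E] [FiniteDimensional ℝ F] [IsManifold I ∞ M] [SmoothFiberBundle I F A]
  {J : JacobiStructure (I.prod 𝓘(ℝ, F)) (TotalSpace F A)}
  {a b : TotalSpace F A → ℝ} {f g : M → ℝ}

namespace IsStronglyAffine

theorem isAffineFunction_reeb (hJ : J.IsStronglyAffine) (ha : IsAffineFunction I F A a) :
    IsAffineFunction I F A (dirDeriv J.reeb a) := by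
  rw [J.dirDeriv_reeb_eq_neg_bracket]
  simpa only [neg_one_mul] using (hJ.1 a _ ha (.const 1)).const_mul (-1)

theorem dirDeriv_reeb_eq (hJ : J.IsStronglyAffine) (ha : IsAffineFunction I F A a) {x : M}
    (y y' : A x) : dirDeriv J.reeb a ⟨x, y⟩ = dirDeriv J.reeb a ⟨x, y'⟩ := by
  refine (hJ.isAffineFunction_reeb ha).eq_of_mul (fun b hb => ?_) y y'
  have h := (hJ.2 a ha b hb).sub (hJ.1 a b ha hb)
  simpa only [J.dirDeriv_hamiltonian_eq_bracket, add_sub_cancel_left] using h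

theorem dirDeriv_hamiltonian_basic_eq (hJ : J.IsStronglyAffine) (ha : IsAffineFunction I F A a)
    (hf : ContMDiff I 𝓘(ℝ, ℝ) ∞ f) {x : M} (y y' : A x) :
    dirDeriv (J.hamiltonian a) (fun p => f p.proj) ⟨x, y⟩ =
      dirDeriv (J.hamiltonian a) (fun p => f p.proj) ⟨x, y'⟩ := by
  have hfA : IsAffineFunction I F A (fun p => f p.proj) := .basic hf
  refine (hJ.2 a ha _ hfA).eq_of_mul (fun b hb => ?_) y y'
  have h := (hJ.2 a ha _ (hb.basic_mul hf)).sub ((hJ.2 a ha b hb).basic_mul hf)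
  simpa only [dirDeriv_fun_mul _ (hfA.mdifferentiableAt _)
    (hb.mdifferentiableAt _), add_sub_cancel_left] using h

/-- Since `X_{f a}(g) = f X_a(g) + a Λ(df, dg)` for basic `f` and `g`, constancy of `X_{f a}(g)` and
`X_a(g)` along a fibre forces `Λ(df, dg)` to vanish as soon as `a` is not constant there. -/
theorem bivector_basic_eq_zero [AffineBundle F A] [T2Space M] [Nontrivial F]
    (hJ : J.IsStronglyAffine) (hf : ContMDiff I 𝓘(ℝ, ℝ) ∞ f) (hg : ContMDiff I 𝓘(ℝ, ℝ) ∞ g)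
    (p : TotalSpace F A) : J.bivector.apply (fun p => f p.proj) (fun p => g p.proj) p = 0 := by
  have hfA : IsAffineFunction I F A (fun p => f p.proj) := .basic hf
  have hgA : IsAffineFunction I F A (fun p => g p.proj) := .basic hg
  obtain ⟨x, y₀⟩ := p
  have hconst (y : A x) : J.bivector.apply (fun p => f p.proj) (fun p => g p.proj) ⟨x, y⟩ =
      J.bivector.apply (fun p => f p.proj) (fun p => g p.proj) ⟨x, y₀⟩ := by
    have h := hJ.dirDeriv_hamiltonian_basic_eq hfA hg y y₀
    rwa [dirDeriv_hamiltonian, dirDeriv_hamiltonian, hJ.dirDeriv_reeb_eq hgA y y₀,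
      add_left_inj] at h
  obtain ⟨a, ha, y, y', hne⟩ := AffDual.exists_isAffineFunction_ne (I := I) (F := F) (A := A) x
  have hmul (z : A x) :
      dirDeriv (J.hamiltonian fun p => f p.proj * a p) (fun p => g p.proj) ⟨x, z⟩ =
      f x * dirDeriv (J.hamiltonian a) (fun p => g p.proj) ⟨x, z⟩ +
        a ⟨x, z⟩ * J.bivector.apply (fun p => f p.proj) (fun p => g p.proj) ⟨x, z⟩ := by
    rw [dirDeriv, hamiltonian_fun_mul (hfA.mdifferentiableAt _)
      (ha.mdifferentiableAt _), map_add, map_smul, map_smul,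
      ← BivectorField.dirDeriv_sharpDiff]
    rfl
  have h := hJ.dirDeriv_hamiltonian_basic_eq (ha.basic_mul hf) hg y y'
  rw [hmul, hmul, hJ.dirDeriv_hamiltonian_basic_eq ha hg y y', hconst y, hconst y',
    add_right_inj] at h
  exact (mul_eq_mul_right_iff.1 h).resolve_left hne

end IsStronglyAffine

section BaseField

variable (J) in
/-- The vector field on `M` onto which the hamiltonian vector field of an affine function `a` on `A`
projects. In each fibre it is computed at an arbitrary point. -/
def baseField (a : TotalSpace F A → ℝ) (x : M) : TangentSpace I x :=
  let p : TotalSpace F A := ⟨x, Classical.arbitrary (A x)⟩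
  mfderiv (I.prod 𝓘(ℝ, F)) I (π F A) p (J.hamiltonian a p)

theorem baseField_fun_add (ha : IsAffineFunction I F A a) (hb : IsAffineFunction I F A b) (x : M) :
    J.baseField (fun p => a p + b p) x = J.baseField a x + J.baseField b x := by
  rw [baseField, hamiltonian_fun_add (ha.mdifferentiableAt _)
    (hb.mdifferentiableAt _), map_add]
  rfl

namespace IsStronglyAffine

theorem mvfderiv_baseField (hJ : J.IsStronglyAffine) (ha : IsAffineFunction I F A a)
    (hf : ContMDiff I 𝓘(ℝ, ℝ) ∞ f) (p : TotalSpace F A) :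
    mvfderiv I f p.proj (J.baseField a p.proj) =
      dirDeriv (J.hamiltonian a) (fun q => f q.proj) p :=
  (mvfderiv_comp_proj hf ⟨p.proj, Classical.arbitrary (A p.proj)⟩ _).symm.trans
    (hJ.dirDeriv_hamiltonian_basic_eq ha hf _ p.snd)

variable [T2Space M]

section Basic

variable [AffineBundle F A] [Nontrivial F]

theorem mfderiv_proj_sharpDiff_basic (hJ : J.IsStronglyAffine) (hf : ContMDiff I 𝓘(ℝ, ℝ) ∞ f)
    (p : TotalSpace F A) : mfderiv (I.prod 𝓘(ℝ, F)) I (π F A) p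
      (J.bivector.sharpDiff (fun q => f q.proj) p) = 0 := by
  obtain ⟨c, hc⟩ := exists_isCoordFamily (I := I) p.proj
  refine hc.eq_of_mvfderiv_eq fun ℓ => ?_
  rw [← mvfderiv_comp_proj (hc.contMDiff ℓ), map_zero,
    ← hJ.bivector_basic_eq_zero hf (hc.contMDiff ℓ) p, ← BivectorField.dirDeriv_sharpDiff]
  rfl

theorem baseField_basic_mul (hJ : J.IsStronglyAffine) (hf : ContMDiff I 𝓘(ℝ, ℝ) ∞ f)
    (ha : IsAffineFunction I F A a) (x : M) :
    J.baseField (fun p => f p.proj * a p) x = f x • J.baseField a x := by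
  have hfA : IsAffineFunction I F A (fun p => f p.proj) := .basic hf
  rw [baseField, hamiltonian_fun_mul (hfA.mdifferentiableAt _)
    (ha.mdifferentiableAt _), map_add, map_smul, map_smul,
    hJ.mfderiv_proj_sharpDiff_basic hf, smul_zero, add_zero]
  rfl

end Basic

theorem contMDiff_baseField (hJ : J.IsStronglyAffine) (ha : IsAffineFunction I F A a) :
    ContMDiff I I.tangent ∞ (T% (J.baseField a)) := fun x₀ => by
  obtain ⟨c, hc⟩ := exists_isCoordFamily (I := I) x₀
  refine hc.contMDiffAt_vectorField fun ℓ => ?_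
  obtain ⟨g, hg, hg'⟩ := IsAffineFunction.exists_basic
    (hJ.2 a ha _ (.basic (hc.contMDiff ℓ))).contMDiff
    fun _ => hJ.dirDeriv_hamiltonian_basic_eq ha (hc.contMDiff ℓ)
  refine hg.contMDiffAt.congr_of_eventuallyEq (.of_forall fun x => ?_)
  exact (hJ.mvfderiv_baseField ha (hc.contMDiff ℓ) ⟨x, Classical.arbitrary (A x)⟩).trans (hg' _)

end IsStronglyAffine

end BaseField

section ToLieAlgebroid

variable [AffineBundle F A]

variable (J) in
/-- The bracket on sections of `A⁺` given by an affine Jacobi structure on `A`. -/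
def sectionBracket (hJ : J.IsAffine) (s t : Cₛ^∞⟮I; F →ᴬ[ℝ] ℝ, AffDual A⟯) :
    Cₛ^∞⟮I; F →ᴬ[ℝ] ℝ, AffDual A⟯ :=
  AffDual.ofFunction (J.bracket (AffDual.toFunction s) (AffDual.toFunction t))
    (hJ _ _ (AffDual.isAffineFunction_toFunction s) (AffDual.isAffineFunction_toFunction t))

theorem toFunction_sectionBracket (hJ : J.IsAffine) (s t : Cₛ^∞⟮I; F →ᴬ[ℝ] ℝ, AffDual A⟯) :
    AffDual.toFunction (J.sectionBracket hJ s t) =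
      J.bracket (AffDual.toFunction s) (AffDual.toFunction t) :=
  AffDual.toFunction_ofFunction _

theorem sectionBracket_swap (hJ : J.IsAffine) (s t : Cₛ^∞⟮I; F →ᴬ[ℝ] ℝ, AffDual A⟯) :
    J.sectionBracket hJ s t = - J.sectionBracket hJ t s :=
  AffDual.toFunction_injective <| funext fun p => by
    change _ = - AffDual.toFunction _ p
    rw [toFunction_sectionBracket, toFunction_sectionBracket, J.bracket_swap]

theorem sectionBracket_add (hJ : J.IsAffine) (s t t' : Cₛ^∞⟮I; F →ᴬ[ℝ] ℝ, AffDual A⟯) :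
    J.sectionBracket hJ s (t + t') = J.sectionBracket hJ s t + J.sectionBracket hJ s t' :=
  AffDual.toFunction_injective <| funext fun p => by
    change _ = AffDual.toFunction _ p + AffDual.toFunction _ p
    simp only [toFunction_sectionBracket]
    exact bracket_fun_add _ ((AffDual.isAffineFunction_toFunction t).mdifferentiableAt p)
      ((AffDual.isAffineFunction_toFunction t').mdifferentiableAt p)

theorem sectionBracket_smul (hJ : J.IsAffine) (c : ℝ) (s t : Cₛ^∞⟮I; F →ᴬ[ℝ] ℝ, AffDual A⟯) :
    J.sectionBracket hJ s (c • t) = c • J.sectionBracket hJ s t :=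
  AffDual.toFunction_injective <| funext fun p => by
    change _ = c * AffDual.toFunction _ p
    simp only [toFunction_sectionBracket]
    exact bracket_const_mul _ c ((AffDual.isAffineFunction_toFunction t).mdifferentiableAt p)

variable [T2Space M] [Nontrivial F]

namespace IsStronglyAffine

theorem exists_anchor (hJ : J.IsStronglyAffine) (x : M) :
    ∃ ρ : AffDual A x →ₗ[ℝ] TangentSpace I x, ∀ s : Cₛ^∞⟮I; F →ᴬ[ℝ] ℝ, AffDual A⟯,
      ρ (s x) = J.baseField (AffDual.toFunction s) x :=
  exists_linearMap_apply_section
    (D := {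
      toFun := fun s => J.baseField (AffDual.toFunction s) x
      map_add' := fun s t => baseField_fun_add (AffDual.isAffineFunction_toFunction s)
        (AffDual.isAffineFunction_toFunction t) x
      map_smul' := fun c s => hJ.baseField_basic_mul (f := fun _ => c) contMDiff_const
        (AffDual.isAffineFunction_toFunction s) x })
    fun f s => hJ.baseField_basic_mul f.contMDiff (AffDual.isAffineFunction_toFunction s) x

/-- The anchor of the Lie algebroid of a strongly-affine Jacobi structure: the projection to `M` of
hamiltonian vector fields. -/
def anchor (hJ : J.IsStronglyAffine) (x : M) : AffDual A x →ₗ[ℝ] TangentSpace I x :=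
  (hJ.exists_anchor x).choose

theorem anchor_apply (hJ : J.IsStronglyAffine) (x : M) (s : Cₛ^∞⟮I; F →ᴬ[ℝ] ℝ, AffDual A⟯) :
    anchor hJ x (s x) = J.baseField (AffDual.toFunction s) x :=
  (hJ.exists_anchor x).choose_spec s

/-- The Lie algebroid structure on `A⁺` given by a strongly-affine Jacobi structure on `A`. -/
def toLieAlgebroid (hJ : J.IsStronglyAffine) : LieAlgebroid I (F →ᴬ[ℝ] ℝ) (AffDual A) where
  bracket := LinearMap.mk₂ ℝ (J.sectionBracket hJ.1)
    (fun s s' t => by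
      rw [sectionBracket_swap, sectionBracket_add, sectionBracket_swap hJ.1 s,
        sectionBracket_swap hJ.1 s', neg_add])
    (fun c s t => by
      rw [sectionBracket_swap, sectionBracket_smul, sectionBracket_swap hJ.1 s, smul_neg])
    (sectionBracket_add hJ.1) (fun c s t => sectionBracket_smul hJ.1 c s t)
  anchor := anchor hJ
  bracket_self s := AffDual.toFunction_injective <|
    (toFunction_sectionBracket hJ.1 s s).trans (funext (J.bracket_self _))
  jacobi s t r := AffDual.toFunction_injective <| funext fun p => by
    have h (u : Cₛ^∞⟮I; F →ᴬ[ℝ] ℝ, AffDual A⟯) := (AffDual.isAffineFunction_toFunction u).contMDiff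
    have key := J.bracket_jacobi (h s) (h t) (h r) p
    simp only [← toFunction_sectionBracket hJ.1] at key
    exact key
  anchor_smooth := contMDiff_linearMap_of_section (ρ := anchor hJ) fun s => by
    simp only [anchor_apply]
    exact hJ.contMDiff_baseField (AffDual.isAffineFunction_toFunction s)
  leibniz s t f x := AffineMap.ext fun y => by
    have hs := AffDual.isAffineFunction_toFunction s
    have ht := AffDual.isAffineFunction_toFunction t
    have hf : IsAffineFunction I F A (fun p => f p.proj) := .basic f.contMDiff
    rw [anchor_apply, hJ.mvfderiv_baseField hs f.contMDiff ⟨x, y⟩]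
    refine (congrFun (toFunction_sectionBracket hJ.1 s (f • t)) ⟨x, y⟩).trans ?_
    rw [AffDual.toFunction_smul, bracket_fun_mul _ (hf.mdifferentiableAt _)
      (ht.mdifferentiableAt _), ← toFunction_sectionBracket hJ.1]
    rfl

theorem toFunction_toLieAlgebroid_bracket (hJ : J.IsStronglyAffine)
    (s t : Cₛ^∞⟮I; F →ᴬ[ℝ] ℝ, AffDual A⟯) :
    AffDual.toFunction (hJ.toLieAlgebroid.bracket s t) =
      J.bracket (AffDual.toFunction s) (AffDual.toFunction t) :=
  toFunction_sectionBracket hJ.1 s t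

theorem isAlmostSpecial_toLieAlgebroid (hJ : J.IsStronglyAffine) :
    hJ.toLieAlgebroid.IsAlmostSpecial (AffDual.oneSection I F A) := by
  intro s Z hZ
  obtain ⟨f, rfl⟩ := Submodule.mem_span_singleton.1 hZ
  have hs := AffDual.isAffineFunction_toFunction s
  have hf : AffDual.toFunction (f • AffDual.oneSection I F A) = fun p => f p.proj :=
    funext fun p => mul_one (f p.proj)
  have hb := hJ.toFunction_toLieAlgebroid_bracket s (f • AffDual.oneSection I F A)
  rw [hf] at hb
  obtain ⟨g, hg, hg'⟩ := IsAffineFunction.exists_basic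
    (hJ.1 _ _ hs (.basic f.contMDiff)).contMDiff fun x y y' => by
      have h := hJ.dirDeriv_hamiltonian_basic_eq hs f.contMDiff y y'
      rwa [J.dirDeriv_hamiltonian_eq_bracket, J.dirDeriv_hamiltonian_eq_bracket,
        hJ.dirDeriv_reeb_eq hs y y', add_left_inj] at h
  refine Submodule.mem_span_singleton.2 ⟨⟨g, hg⟩, AffDual.toFunction_injective ?_⟩
  exact hb ▸ funext fun p => (mul_one (g p.proj)).trans (hg' p).symm

end IsStronglyAffine

end ToLieAlgebroid

end StronglyAffine

end JacobiStructure

section Sections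

variable {E : Type*} [NormedAddCommGroup E] [NormedSpace ℝ E]
  {H : Type*} [TopologicalSpace H] {I : ModelWithCorners ℝ E H}
  {M : Type*} [TopologicalSpace M] [ChartedSpace H M]
  {F : Type*} [NormedAddCommGroup F] [NormedSpace ℝ F] [FiniteDimensional ℝ F]
  {V : M → Type*} [∀ x, AddCommGroup (V x)] [∀ x, Module ℝ (V x)]
  {A : M → Type*} [∀ x, AddTorsor (V x) (A x)] [∀ x, TopologicalSpace (A x)]
  [TopologicalSpace (TotalSpace F A)] [FiberBundle F A] [AffineBundle F A]
  [SmoothFiberBundle I F A]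

namespace AffDual

/-- The value at `p` of the affine function corresponding to a section of `A⁺`. -/
def evalAt (p : TotalSpace F A) : Cₛ^∞⟮I; F →ᴬ[ℝ] ℝ, AffDual A⟯ →ₗ[ℝ] ℝ where
  toFun s := toFunction s p
  map_add' _ _ := rfl
  map_smul' _ _ := rfl

/-- The differential at `p` of the affine function corresponding to a section of `A⁺`. -/
def differentialAt (p : TotalSpace F A) : Cₛ^∞⟮I; F →ᴬ[ℝ] ℝ, AffDual A⟯ →ₗ[ℝ]
    Module.Dual ℝ (TangentSpace (I.prod 𝓘(ℝ, F)) p) where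
  toFun s := (mvfderiv (I.prod 𝓘(ℝ, F)) (toFunction s) p).toLinearMap
  map_add' s t := LinearMap.ext fun v => DFunLike.congr_fun
    (mvfderiv_fun_add ((isAffineFunction_toFunction s).mdifferentiableAt p)
      ((isAffineFunction_toFunction t).mdifferentiableAt p)) v
  map_smul' c s := LinearMap.ext fun v => by
    refine (DFunLike.congr_fun (mvfderiv_fun_mul mdifferentiableAt_const
      ((isAffineFunction_toFunction s).mdifferentiableAt p)) v).trans ?_
    simp [mvfderiv_const]

theorem differentialAt_smul (p : TotalSpace F A) (f : C^∞⟮I, M; 𝓘(ℝ, ℝ), ℝ⟯)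
    (s : Cₛ^∞⟮I; F →ᴬ[ℝ] ℝ, AffDual A⟯) (v : TangentSpace (I.prod 𝓘(ℝ, F)) p) :
    differentialAt p (f • s) v = f p.proj * differentialAt p s v + toFunction s p *
      mvfderiv I f p.proj (mfderiv (I.prod 𝓘(ℝ, F)) I (π F A) p v) := by
  rw [← mvfderiv_comp_proj f.contMDiff]
  exact DFunLike.congr_fun (mvfderiv_fun_mul
    ((IsAffineFunction.basic f.contMDiff).mdifferentiableAt p)
    ((isAffineFunction_toFunction s).mdifferentiableAt p)) v

theorem differentialAt_oneSection (p : TotalSpace F A) :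
    differentialAt p (oneSection I F A) = 0 := by
  ext v
  exact DFunLike.congr_fun (mvfderiv_const ..) v

variable [FiniteDimensional ℝ E] [T2Space M] [IsManifold I ∞ M] {x₀ : M}
  {χ : SmoothBumpFunction I x₀}

theorem coordSection_comp_fst (hχ : tsupport χ ⊆ (trivializationAt F A x₀).baseSet)
    (ℓ : Module.Dual ℝ E) :
    coordSection hχ (ℓ ∘ₗ LinearMap.fst ℝ E F) =
      bumpCoord χ ℓ • oneSection I F A :=
  toFunction_injective <| funext fun p =>
    (toFunction_coordSection hχ _ p).trans (mul_one _).symm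

theorem exists_eq_one_add_coordSection (hχ : tsupport χ ⊆ (trivializationAt F A x₀).baseSet)
    (α : AffDual A x₀) :
    ∃ (c : ℝ) (ℓ : Module.Dual ℝ (E × F)),
      c • oneSection I F A x₀ + coordSection hχ ℓ x₀ = α := by
  let φ : F →ᴬ[ℝ] ℝ := (trivializationAt (F →ᴬ[ℝ] ℝ) (AffDual A) x₀ ⟨x₀, α⟩).2
  refine ⟨φ 0, φ.contLinear.toLinearMap ∘ₗ LinearMap.snd ℝ E F, AffineMap.ext fun y => ?_⟩
  refine Eq.trans ?_
    (toAffineMap_eq_trivializationAt (mem_baseSet_trivializationAt F A x₀) α y).symm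
  change φ 0 * 1 + toFunction (coordSection hχ _) ⟨x₀, y⟩ = φ _
  rw [toFunction_coordSection, χ.eq_one, one_mul, mul_one, φ.decomp]
  simp [add_comm]

theorem map_eq_zero_of_coordSection {T : Type*} [AddCommGroup T] [Module ℝ T]
    {D : Cₛ^∞⟮I; F →ᴬ[ℝ] ℝ, AffDual A⟯ →ₗ[ℝ] T}
    (hD : ∀ (f : C^∞⟮I, M; 𝓘(ℝ, ℝ), ℝ⟯) s, D (f • s) = f x₀ • D s)
    (hone : D (oneSection I F A) = 0) (hχ : tsupport χ ⊆ (trivializationAt F A x₀).baseSet)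
    (hcoord : ∀ ℓ, D (coordSection hχ ℓ) = 0) (s : Cₛ^∞⟮I; F →ᴬ[ℝ] ℝ, AffDual A⟯) : D s = 0 := by
  obtain ⟨c, ℓ, h⟩ := exists_eq_one_add_coordSection hχ (s x₀)
  have key : D (s - (c • oneSection I F A + coordSection hχ ℓ)) = 0 :=
    map_section_eq_zero_of_apply_eq_zero hD (sub_eq_zero.2 h.symm)
  simpa only [map_sub, map_add, map_smul, hone, hcoord, smul_zero, add_zero, sub_zero] using key

theorem differentialAt_coordSection (hχ : tsupport χ ⊆ (trivializationAt F A x₀).baseSet)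
    (y₀ : A x₀) (ℓ : Module.Dual ℝ (E × F)) :
    differentialAt ⟨x₀, y₀⟩ (coordSection hχ ℓ) = ℓ :=
  LinearMap.ext ((isCoordFamily_coordSection hχ y₀).mvfderiv_self ℓ)

variable (I) in
theorem exists_isCoordFamily_toFunction (p : TotalSpace F A) :
    ∃ c : Module.Dual ℝ (E × F) → Cₛ^∞⟮I; F →ᴬ[ℝ] ℝ, AffDual A⟯,
      IsCoordFamily (I.prod 𝓘(ℝ, F)) (fun ℓ => toFunction (c ℓ)) p :=
  let ⟨_, hχ⟩ := exists_smoothBumpFunction_tsupport_subset (I := I)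
    ((trivializationAt F A p.proj).open_baseSet.mem_nhds (mem_baseSet_trivializationAt F A p.proj))
  ⟨coordSection hχ, isCoordFamily_coordSection hχ p.snd⟩

theorem differentialAt_surjective (p : TotalSpace F A) :
    Function.Surjective (differentialAt (I := I) p) := fun α =>
  let ⟨c, hc⟩ := exists_isCoordFamily_toFunction I p
  ⟨c α, LinearMap.ext (hc.mvfderiv_self α)⟩

/-- The candidate `v` is read off on affine coordinates. Its projection to `M` is `w`, so that
`D - d(·) v` is linear over smooth functions and may be tested on an affine frame. -/
theorem exists_differentialAt_eq {p : TotalSpace F A} {w : TangentSpace I p.proj}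
    {D : Cₛ^∞⟮I; F →ᴬ[ℝ] ℝ, AffDual A⟯ →ₗ[ℝ] ℝ}
    (hD : ∀ (f : C^∞⟮I, M; 𝓘(ℝ, ℝ), ℝ⟯) s,
      D (f • s) = f p.proj * D s + toFunction s p * mvfderiv I f p.proj w)
    (hone : D (oneSection I F A) = 0) :
    ∃ v : TangentSpace (I.prod 𝓘(ℝ, F)) p, ∀ s, differentialAt p s v = D s := by
  obtain ⟨χ, hχ⟩ := exists_smoothBumpFunction_tsupport_subset (I := I)
    ((trivializationAt F A p.proj).open_baseSet.mem_nhds (mem_baseSet_trivializationAt F A p.proj))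
  let v : TangentSpace (I.prod 𝓘(ℝ, F)) p :=
    (Module.evalEquiv ℝ (E × F)).symm (D ∘ₗ coordSection hχ)
  have hcoord (ℓ : Module.Dual ℝ (E × F)) :
      differentialAt p (coordSection hχ ℓ) v = D (coordSection hχ ℓ) :=
    (DFunLike.congr_fun (differentialAt_coordSection hχ p.snd ℓ) v).trans
      (Module.apply_evalEquiv_symm_apply ℝ _ ℓ _)
  have hw : mfderiv (I.prod 𝓘(ℝ, F)) I (π F A) p v = w :=
    (isCoordFamily_bumpCoord χ).eq_of_mvfderiv_eq fun ℓ => by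
      have h := hcoord (ℓ ∘ₗ LinearMap.fst ℝ E F)
      rw [coordSection_comp_fst, differentialAt_smul, differentialAt_oneSection, hD, hone,
        LinearMap.zero_apply] at h
      exact mul_left_cancel₀ one_ne_zero (add_left_cancel h)
  refine ⟨v, fun s => sub_eq_zero.1 (map_eq_zero_of_coordSection
    (D := LinearMap.applyₗ v ∘ₗ differentialAt p - D) (fun f s => ?_) ?_ hχ
    (fun ℓ => sub_eq_zero.2 (hcoord ℓ)) s)⟩
  · change differentialAt p (f • s) v - D (f • s) = f p.proj * (differentialAt p s v - D s)
    rw [differentialAt_smul, hw, hD]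
    ring
  · change differentialAt p (oneSection I F A) v - D (oneSection I F A) = 0
    rw [differentialAt_oneSection, hone, LinearMap.zero_apply, sub_zero]

end AffDual

end Sections

namespace LieAlgebroid

open AffDual BivectorField

variable {E : Type*} [NormedAddCommGroup E] [NormedSpace ℝ E]
  {H : Type*} [TopologicalSpace H] {I : ModelWithCorners ℝ E H}
  {M : Type*} [TopologicalSpace M] [ChartedSpace H M]
  {F : Type*} [NormedAddCommGroup F] [NormedSpace ℝ F] [FiniteDimensional ℝ F]
  {V : M → Type*} [∀ x, AddCommGroup (V x)] [∀ x, Module ℝ (V x)]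
  {A : M → Type*} [∀ x, AddTorsor (V x) (A x)] [∀ x, TopologicalSpace (A x)]
  [TopologicalSpace (TotalSpace F A)] [FiberBundle F A] [AffineBundle F A]
  [SmoothFiberBundle I F A]

section Pairing

variable [IsManifold I ∞ M] (L : LieAlgebroid I (F →ᴬ[ℝ] ℝ) (AffDual A))

theorem bracket_swap (s t : Cₛ^∞⟮I; F →ᴬ[ℝ] ℝ, AffDual A⟯) : L.bracket s t = - L.bracket t s :=
  (LinearMap.IsAlt.neg (B := L.bracket) L.bracket_self t s).symm

theorem toFunction_bracket_smul (s t : Cₛ^∞⟮I; F →ᴬ[ℝ] ℝ, AffDual A⟯)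
    (f : C^∞⟮I, M; 𝓘(ℝ, ℝ), ℝ⟯) (p : TotalSpace F A) :
    toFunction (L.bracket s (f • t)) p = f p.proj * toFunction (L.bracket s t) p +
      mvfderiv I f p.proj (L.anchor p.proj (s p.proj)) * toFunction t p :=
  congrArg (fun α : AffDual A p.proj => α.toAffineMap p.snd) (L.leibniz s t f p.proj)

theorem mvfderiv_anchor (s : Cₛ^∞⟮I; F →ᴬ[ℝ] ℝ, AffDual A⟯) (f : C^∞⟮I, M; 𝓘(ℝ, ℝ), ℝ⟯)
    (p : TotalSpace F A) :
    mvfderiv I f p.proj (L.anchor p.proj (s p.proj)) =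
      toFunction (L.bracket s (f • oneSection I F A)) p -
        f p.proj * toFunction (L.bracket s (oneSection I F A)) p := by
  rw [L.toFunction_bracket_smul, add_sub_cancel_left]
  exact (mul_one _).symm

/-- The endomorphism `⟦1, ·⟧` of the sections of `A⁺`, which is the Reeb vector field acting on
affine functions. -/
def reebSection : Cₛ^∞⟮I; F →ᴬ[ℝ] ℝ, AffDual A⟯ →ₗ[ℝ] Cₛ^∞⟮I; F →ᴬ[ℝ] ℝ, AffDual A⟯ :=
  L.bracket (oneSection I F A)

theorem bracket_oneSection (s : Cₛ^∞⟮I; F →ᴬ[ℝ] ℝ, AffDual A⟯) :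
    L.bracket s (oneSection I F A) = - L.reebSection s :=
  L.bracket_swap _ _

theorem reebSection_oneSection : L.reebSection (oneSection I F A) = 0 :=
  L.bracket_self _

variable {L}

theorem IsAlmostSpecial.exists_reebSection_eq (hL : L.IsAlmostSpecial (oneSection I F A))
    (s : Cₛ^∞⟮I; F →ᴬ[ℝ] ℝ, AffDual A⟯) :
    ∃ f : C^∞⟮I, M; 𝓘(ℝ, ℝ), ℝ⟯, f • oneSection I F A = L.reebSection s := by
  obtain ⟨f, hf⟩ := Submodule.mem_span_singleton.1
    (hL s _ (Submodule.mem_span_singleton_self (oneSection I F A)))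
  exact ⟨-f, by rw [neg_smul, hf, bracket_oneSection, neg_neg]⟩

theorem IsAlmostSpecial.toFunction_reebSection_eq (hL : L.IsAlmostSpecial (oneSection I F A))
    (s : Cₛ^∞⟮I; F →ᴬ[ℝ] ℝ, AffDual A⟯) {x : M} (y y' : A x) :
    toFunction (L.reebSection s) ⟨x, y⟩ = toFunction (L.reebSection s) ⟨x, y'⟩ := by
  obtain ⟨f, hf⟩ := hL.exists_reebSection_eq s
  rw [← hf]
  rfl

variable (L) in
/-- The function `Λ(da, db) = ⟦a, b⟧ - a E(b) + b E(a)` on `A`, evaluated at `p`, where `E` is the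
Reeb vector field. -/
def bivectorPairing (p : TotalSpace F A) :
    Cₛ^∞⟮I; F →ᴬ[ℝ] ℝ, AffDual A⟯ →ₗ[ℝ] Cₛ^∞⟮I; F →ᴬ[ℝ] ℝ, AffDual A⟯ →ₗ[ℝ] ℝ :=
  L.bracket.compr₂ (evalAt p) - (LinearMap.mul ℝ ℝ).compl₁₂ (evalAt p) (evalAt p ∘ₗ L.reebSection)
    + (LinearMap.mul ℝ ℝ).compl₁₂ (evalAt p ∘ₗ L.reebSection) (evalAt p)

theorem bivectorPairing_apply (p : TotalSpace F A) (s t : Cₛ^∞⟮I; F →ᴬ[ℝ] ℝ, AffDual A⟯) :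
    L.bivectorPairing p s t = toFunction (L.bracket s t) p
      - toFunction s p * toFunction (L.reebSection t) p
      + toFunction (L.reebSection s) p * toFunction t p := rfl

theorem isAlt_bivectorPairing (p : TotalSpace F A) : (L.bivectorPairing p).IsAlt := fun s => by
  rw [bivectorPairing_apply, L.bracket_self, mul_comm, sub_add_cancel]
  rfl

theorem contMDiff_bivectorPairing (s t : Cₛ^∞⟮I; F →ᴬ[ℝ] ℝ, AffDual A⟯) :
    ContMDiff (I.prod 𝓘(ℝ, F)) 𝓘(ℝ, ℝ) ∞ fun p => L.bivectorPairing p s t := by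
  have hsmooth (u : Cₛ^∞⟮I; F →ᴬ[ℝ] ℝ, AffDual A⟯) := (isAffineFunction_toFunction u).contMDiff
  exact ((hsmooth _).sub ((hsmooth _).mul (hsmooth _))).add ((hsmooth _).mul (hsmooth _))

end Pairing

variable [FiniteDimensional ℝ E] [T2Space M] [IsManifold I ∞ M]
  {L : LieAlgebroid I (F →ᴬ[ℝ] ℝ) (AffDual A)}

namespace IsAlmostSpecial

variable [Nontrivial F]

/-- For a section `s` not constant on the fibre, `⟦1, fs⟧` and `f ⟦1, s⟧` are constant on it, hence
so is their difference `ρ(1)(f) s`. -/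
theorem mvfderiv_anchor_oneSection (hL : L.IsAlmostSpecial (oneSection I F A))
    (f : C^∞⟮I, M; 𝓘(ℝ, ℝ), ℝ⟯) (x : M) :
    mvfderiv I f x (L.anchor x (oneSection I F A x)) = 0 := by
  obtain ⟨a, ha, y, y', hne⟩ := exists_isAffineFunction_ne (I := I) (F := F) (A := A) x
  have hy := L.toFunction_bracket_smul (oneSection I F A) (ofFunction a ha) f ⟨x, y⟩
  have hy' := L.toFunction_bracket_smul (oneSection I F A) (ofFunction a ha) f ⟨x, y'⟩
  change toFunction (L.reebSection _) _ = _ * toFunction (L.reebSection _) _ + _ at hy hy'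
  rw [hL.toFunction_reebSection_eq _ y y', hL.toFunction_reebSection_eq _ y y', hy',
    add_right_inj, toFunction_ofFunction] at hy
  exact (mul_eq_mul_left_iff.1 hy).resolve_left hne.symm

theorem reebSection_smul (hL : L.IsAlmostSpecial (oneSection I F A))
    (f : C^∞⟮I, M; 𝓘(ℝ, ℝ), ℝ⟯) (s : Cₛ^∞⟮I; F →ᴬ[ℝ] ℝ, AffDual A⟯) (p : TotalSpace F A) :
    toFunction (L.reebSection (f • s)) p = f p.proj * toFunction (L.reebSection s) p := by
  refine (L.toFunction_bracket_smul _ s f p).trans ?_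
  rw [hL.mvfderiv_anchor_oneSection, zero_mul, add_zero]
  rfl

theorem exists_reeb (hL : L.IsAlmostSpecial (oneSection I F A)) (p : TotalSpace F A) :
    ∃ v : TangentSpace (I.prod 𝓘(ℝ, F)) p, ∀ s,
      differentialAt p s v = toFunction (L.reebSection s) p :=
  exists_differentialAt_eq (w := 0) (D := evalAt p ∘ₗ L.reebSection)
    (fun f s => by
      rw [map_zero, mul_zero, add_zero]
      exact hL.reebSection_smul f s p)
    (congrArg (evalAt p) L.reebSection_oneSection)

theorem exists_sharp (hL : L.IsAlmostSpecial (oneSection I F A)) (p : TotalSpace F A)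
    (s : Cₛ^∞⟮I; F →ᴬ[ℝ] ℝ, AffDual A⟯) :
    ∃ v : TangentSpace (I.prod 𝓘(ℝ, F)) p, ∀ t,
      differentialAt p t v = L.bivectorPairing p s t := by
  refine exists_differentialAt_eq (w := L.anchor p.proj (s p.proj)) (fun f t => ?_) ?_
  · rw [bivectorPairing_apply, bivectorPairing_apply, L.toFunction_bracket_smul,
      hL.reebSection_smul, toFunction_smul]
    ring
  · rw [bivectorPairing_apply, L.bracket_oneSection, L.reebSection_oneSection]
    change - toFunction _ p - toFunction s p * 0 + toFunction _ p * 1 = 0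
    ring

theorem exists_bivectorForm (hL : L.IsAlmostSpecial (oneSection I F A)) (p : TotalSpace F A) :
    ∃ Λ : LinearMap.BilinForm ℝ (Module.Dual ℝ (TangentSpace (I.prod 𝓘(ℝ, F)) p)), ∀ s t,
      Λ (differentialAt p s) (differentialAt p t) = L.bivectorPairing p s t := by
  obtain ⟨σ, hσ⟩ := (differentialAt p).exists_rightInverse_of_surjective
    (LinearMap.range_eq_top.2 (differentialAt_surjective (I := I) p))
  have hσd (s) : differentialAt p (σ (differentialAt p s)) = differentialAt p s :=
    LinearMap.congr_fun hσ _
  have hright (s t) :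
      L.bivectorPairing p s (σ (differentialAt p t)) = L.bivectorPairing p s t := by
    obtain ⟨v, hv⟩ := hL.exists_sharp p s
    rw [← hv, ← hv, hσd]
  refine ⟨(L.bivectorPairing p).compl₁₂ σ σ, fun s t => ?_⟩
  rw [LinearMap.compl₁₂_apply, hright, ← (isAlt_bivectorPairing p).neg, hright,
    (isAlt_bivectorPairing p).neg]

/-- The Reeb vector field of an almost-special Lie algebroid structure on `A⁺`. -/
def reeb (hL : L.IsAlmostSpecial (oneSection I F A)) (p : TotalSpace F A) :
    TangentSpace (I.prod 𝓘(ℝ, F)) p :=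
  (hL.exists_reeb p).choose

theorem dirDeriv_reeb (hL : L.IsAlmostSpecial (oneSection I F A))
    (s : Cₛ^∞⟮I; F →ᴬ[ℝ] ℝ, AffDual A⟯) :
    dirDeriv hL.reeb (toFunction s) = toFunction (L.reebSection s) :=
  funext fun p => (hL.exists_reeb p).choose_spec s

theorem contMDiff_reeb (hL : L.IsAlmostSpecial (oneSection I F A)) :
    ContMDiff (I.prod 𝓘(ℝ, F)) (I.prod 𝓘(ℝ, F)).tangent ∞ (T% hL.reeb) := fun p =>
  let ⟨c, hc⟩ := exists_isCoordFamily_toFunction I p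
  hc.contMDiffAt_vectorField fun ℓ => by
    rw [hL.dirDeriv_reeb (c ℓ)]
    exact (isAffineFunction_toFunction _).contMDiff.contMDiffAt

/-- The bivector field of an almost-special Lie algebroid structure on `A⁺`. -/
def bivector (hL : L.IsAlmostSpecial (oneSection I F A)) :
    BivectorField (I.prod 𝓘(ℝ, F)) (TotalSpace F A) where
  toFun p := (hL.exists_bivectorForm p).choose
  alternating p α := by
    obtain ⟨s, rfl⟩ := differentialAt_surjective (I := I) p α
    exact ((hL.exists_bivectorForm p).choose_spec s s).trans (isAlt_bivectorPairing p s)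
  smooth f g hf hg p :=
    let ⟨c, hc⟩ := exists_isCoordFamily_toFunction I p
    hc.contMDiffAt_bilinForm_mvfderiv (fun ℓ ℓ' =>
      (contMDiff_bivectorPairing (L := L) (c ℓ) (c ℓ')).contMDiffAt.congr_of_eventuallyEq
        (.of_forall fun q => (hL.exists_bivectorForm q).choose_spec _ _)) hf hg

theorem jacobiBracket_toFunction (hL : L.IsAlmostSpecial (oneSection I F A))
    (s t : Cₛ^∞⟮I; F →ᴬ[ℝ] ℝ, AffDual A⟯) :
    jacobiBracket hL.bivector hL.reeb (toFunction s) (toFunction t) =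
      toFunction (L.bracket s t) := by
  funext p
  have hbivector : hL.bivector.apply (toFunction s) (toFunction t) p = L.bivectorPairing p s t :=
    (hL.exists_bivectorForm p).choose_spec s t
  rw [jacobiBracket, hbivector, dirDeriv_reeb, dirDeriv_reeb, bivectorPairing_apply]
  ring

theorem jacobiator_toFunction (hL : L.IsAlmostSpecial (oneSection I F A))
    (s t r : Cₛ^∞⟮I; F →ᴬ[ℝ] ℝ, AffDual A⟯) (p : TotalSpace F A) :
    jacobiBracket hL.bivector hL.reeb (toFunction s)
        (jacobiBracket hL.bivector hL.reeb (toFunction t) (toFunction r)) p +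
      jacobiBracket hL.bivector hL.reeb (toFunction t)
        (jacobiBracket hL.bivector hL.reeb (toFunction r) (toFunction s)) p +
      jacobiBracket hL.bivector hL.reeb (toFunction r)
        (jacobiBracket hL.bivector hL.reeb (toFunction s) (toFunction t)) p = 0 := by
  simp only [jacobiBracket_toFunction]
  exact congrFun (congrArg toFunction (L.jacobi s t r)) p

theorem schoutenVector_toFunction (hL : L.IsAlmostSpecial (oneSection I F A))
    (s t : Cₛ^∞⟮I; F →ᴬ[ℝ] ℝ, AffDual A⟯) (p : TotalSpace F A) :
    schoutenVector hL.reeb hL.bivector (toFunction s) (toFunction t) p = 0 := by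
  rw [← jacobiator_one_eq hL.contMDiff_reeb (isAffineFunction_toFunction s).contMDiff
    (isAffineFunction_toFunction t).contMDiff]
  exact hL.jacobiator_toFunction (oneSection I F A) s t p

theorem schoutenSelf_toFunction (hL : L.IsAlmostSpecial (oneSection I F A))
    (s t r : Cₛ^∞⟮I; F →ᴬ[ℝ] ℝ, AffDual A⟯) (p : TotalSpace F A) :
    hL.bivector.schoutenSelf (toFunction s) (toFunction t) (toFunction r) p =
      -2 * wedgeVector hL.reeb hL.bivector (toFunction s) (toFunction t) (toFunction r) p := by
  have h := hL.jacobiator_toFunction s t r p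
  rw [jacobiator_eq hL.contMDiff_reeb (isAffineFunction_toFunction s).contMDiff
    (isAffineFunction_toFunction t).contMDiff (isAffineFunction_toFunction r).contMDiff] at h
  simp only [schoutenVector_toFunction] at h
  linarith

/-- The Jacobi structure on `A` given by an almost-special Lie algebroid structure on `A⁺`. -/
def toJacobiStructure (hL : L.IsAlmostSpecial (oneSection I F A)) :
    JacobiStructure (I.prod 𝓘(ℝ, F)) (TotalSpace F A) where
  bivector := hL.bivector
  reeb := ⟨hL.reeb, hL.contMDiff_reeb⟩
  schouten_self f g h hf hg hh p := by
    obtain ⟨c, hc⟩ := exists_isCoordFamily_toFunction I p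
    obtain ⟨ℓ, hℓ⟩ := hc.exists_mvfderiv_eq (mvfderiv (I.prod 𝓘(ℝ, F)) f p)
    obtain ⟨ℓ', hℓ'⟩ := hc.exists_mvfderiv_eq (mvfderiv (I.prod 𝓘(ℝ, F)) g p)
    obtain ⟨ℓ'', hℓ''⟩ := hc.exists_mvfderiv_eq (mvfderiv (I.prod 𝓘(ℝ, F)) h p)
    refine (schoutenSelf_congr hc hf (hc.contMDiff ℓ) hg (hc.contMDiff ℓ') hh (hc.contMDiff ℓ'')
      hℓ.symm hℓ'.symm hℓ''.symm).trans ((hL.schoutenSelf_toFunction _ _ _ p).trans ?_)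
    exact congrArg (-2 * ·) (wedgeVector_congr _ hℓ hℓ' hℓ'')
  schouten_reeb f g hf hg p := by
    obtain ⟨c, hc⟩ := exists_isCoordFamily_toFunction I p
    obtain ⟨ℓ, hℓ⟩ := hc.exists_mvfderiv_eq (mvfderiv (I.prod 𝓘(ℝ, F)) f p)
    obtain ⟨ℓ', hℓ'⟩ := hc.exists_mvfderiv_eq (mvfderiv (I.prod 𝓘(ℝ, F)) g p)
    exact (schoutenVector_congr hc (hL.contMDiff_reeb.mdifferentiableAt (by simp)) hf
      (hc.contMDiff ℓ) hg (hc.contMDiff ℓ') hℓ.symm hℓ'.symm).trans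
      (hL.schoutenVector_toFunction _ _ p)

theorem toJacobiStructure_bracket (hL : L.IsAlmostSpecial (oneSection I F A))
    (s t : Cₛ^∞⟮I; F →ᴬ[ℝ] ℝ, AffDual A⟯) :
    hL.toJacobiStructure.bracket (toFunction s) (toFunction t) = toFunction (L.bracket s t) :=
  hL.jacobiBracket_toFunction s t

theorem isAffine_toJacobiStructure (hL : L.IsAlmostSpecial (oneSection I F A)) :
    hL.toJacobiStructure.IsAffine := fun a b ha hb => by
  rw [← toFunction_ofFunction ha, ← toFunction_ofFunction hb, toJacobiStructure_bracket]
  exact isAffineFunction_toFunction _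

theorem isStronglyAffine_toJacobiStructure (hL : L.IsAlmostSpecial (oneSection I F A)) :
    hL.toJacobiStructure.IsStronglyAffine := by
  refine ⟨hL.isAffine_toJacobiStructure, fun a ha b hb => ?_⟩
  obtain ⟨f, hf⟩ := hL.exists_reebSection_eq (ofFunction a ha)
  have hreeb : dirDeriv hL.toJacobiStructure.reeb a = fun p => f p.proj := by
    have h := hL.dirDeriv_reeb (ofFunction a ha)
    rw [toFunction_ofFunction, ← hf] at h
    exact h.trans (funext fun p => mul_one _)
  rw [funext (hL.toJacobiStructure.dirDeriv_hamiltonian_eq_bracket a b)]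
  simp only [hreeb, mul_comm (b _)]
  exact (hL.isAffine_toJacobiStructure a b ha hb).add (hb.basic_mul f.contMDiff)

end IsAlmostSpecial

end LieAlgebroid

section Correspondence

open AffDual

variable {E : Type*} [NormedAddCommGroup E] [NormedSpace ℝ E] [FiniteDimensional ℝ E]
  {H : Type*} [TopologicalSpace H] {I : ModelWithCorners ℝ E H}
  {M : Type*} [TopologicalSpace M] [T2Space M] [ChartedSpace H M] [IsManifold I ∞ M]
  {F : Type*} [NormedAddCommGroup F] [NormedSpace ℝ F] [FiniteDimensional ℝ F]
  {V : M → Type*} [∀ x, AddCommGroup (V x)] [∀ x, Module ℝ (V x)]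
  {A : M → Type*} [∀ x, AddTorsor (V x) (A x)] [∀ x, TopologicalSpace (A x)]
  [TopologicalSpace (TotalSpace F A)] [FiberBundle F A] [AffineBundle F A]
  [SmoothFiberBundle I F A]

theorem JacobiStructure.eq_of_bracket_toFunction_eq
    {J J' : JacobiStructure (I.prod 𝓘(ℝ, F)) (TotalSpace F A)}
    (h : ∀ s t : Cₛ^∞⟮I; F →ᴬ[ℝ] ℝ, AffDual A⟯,
      J.bracket (toFunction s) (toFunction t) = J'.bracket (toFunction s) (toFunction t)) :
    J = J' := by
  have hdir (s : Cₛ^∞⟮I; F →ᴬ[ℝ] ℝ, AffDual A⟯) :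
      dirDeriv J.reeb (toFunction s) = dirDeriv J'.reeb (toFunction s) := by
    rw [J.dirDeriv_reeb_eq_neg_bracket, J'.dirDeriv_reeb_eq_neg_bracket]
    exact funext fun p => congrArg Neg.neg (congrFun (h s (oneSection I F A)) p)
  have hreeb : J.reeb = J'.reeb := ContMDiffSection.ext fun p =>
    let ⟨c, hc⟩ := exists_isCoordFamily_toFunction I p
    hc.eq_of_mvfderiv_eq fun ℓ => congrFun (hdir (c ℓ)) p
  have hbivector : J.bivector.toFun = J'.bivector.toFun := funext fun p => by
    refine LinearMap.ext₂ fun α β => ?_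
    obtain ⟨s, rfl⟩ := differentialAt_surjective (I := I) p α
    obtain ⟨t, rfl⟩ := differentialAt_surjective (I := I) p β
    have hst := congrFun (h s t) p
    simp only [bracket, hdir] at hst
    exact add_right_cancel (sub_left_inj.1 hst)
  obtain ⟨⟨Λ, _, _⟩, R, _, _⟩ := J
  obtain ⟨⟨Λ', _, _⟩, R', _, _⟩ := J'
  obtain rfl : Λ = Λ' := hbivector
  obtain rfl : R = R' := hreeb
  rfl

theorem LieAlgebroid.eq_of_toFunction_bracket_eq
    {L L' : LieAlgebroid I (F →ᴬ[ℝ] ℝ) (AffDual A)}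
    (h : ∀ s t, toFunction (L.bracket s t) = toFunction (L'.bracket s t)) : L = L' := by
  have hbracket : L.bracket = L'.bracket := LinearMap.ext₂ fun s t => toFunction_injective (h s t)
  have hanchor : L.anchor = L'.anchor := funext fun x => LinearMap.ext fun α => by
    obtain ⟨s, rfl⟩ := exists_contMDiffSection_eq (I := I) (F := F →ᴬ[ℝ] ℝ) x α
    obtain ⟨c, hc⟩ := exists_isCoordFamily (I := I) x
    refine hc.eq_of_mvfderiv_eq fun ℓ => ?_
    have hL := L.mvfderiv_anchor s ⟨c ℓ, hc.contMDiff ℓ⟩ ⟨x, Classical.arbitrary (A x)⟩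
    rw [hbracket] at hL
    exact hL.trans (L'.mvfderiv_anchor s ⟨c ℓ, hc.contMDiff ℓ⟩ _).symm
  obtain ⟨b, ρ, _, _, _, _⟩ := L
  obtain ⟨b', ρ', _, _, _, _⟩ := L'
  obtain rfl : b = b' := hbracket
  obtain rfl : ρ = ρ' := hanchor
  rfl

/-- The correspondence between strongly-affine Jacobi structures on `A` and almost-special Lie
algebroid structures on `A⁺`. -/
def JacobiStructure.equivLieAlgebroid [Nontrivial F] :
    {J : JacobiStructure (I.prod 𝓘(ℝ, F)) (TotalSpace F A) // J.IsStronglyAffine} ≃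
      {L : LieAlgebroid I (F →ᴬ[ℝ] ℝ) (AffDual A) //
        L.IsAlmostSpecial (oneSection I F A)} where
  toFun J := ⟨J.2.toLieAlgebroid, J.2.isAlmostSpecial_toLieAlgebroid⟩
  invFun L := ⟨L.2.toJacobiStructure, L.2.isStronglyAffine_toJacobiStructure⟩
  left_inv J := Subtype.ext <| eq_of_bracket_toFunction_eq (J' := J.1) fun s t => by
    rw [LieAlgebroid.IsAlmostSpecial.toJacobiStructure_bracket,
      IsStronglyAffine.toFunction_toLieAlgebroid_bracket]
  right_inv L := Subtype.ext <| LieAlgebroid.eq_of_toFunction_bracket_eq (L' := L.1) fun s t => by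
    rw [IsStronglyAffine.toFunction_toLieAlgebroid_bracket,
      LieAlgebroid.IsAlmostSpecial.toJacobiStructure_bracket]

theorem mainTheorem5_general [Nontrivial F] :
    ∃ Φ : {J : JacobiStructure (I.prod 𝓘(ℝ, F)) (TotalSpace F A) // J.IsStronglyAffine} ≃
        {L : LieAlgebroid I (F →ᴬ[ℝ] ℝ) (AffDual A) // L.IsAlmostSpecial (oneSection I F A)},
      (∀ J L, Φ J = L ↔ ∀ a b : Cₛ^∞⟮I; F →ᴬ[ℝ] ℝ, AffDual A⟯,
        toFunction (L.1.bracket a b) = J.1.bracket (toFunction a) (toFunction b)) ∧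
      (∀ J, ∀ (a : Cₛ^∞⟮I; F →ᴬ[ℝ] ℝ, AffDual A⟯) (f : C^∞⟮I, M; 𝓘(ℝ, ℝ), ℝ⟯)
        (p : TotalSpace F A),
        mvfderiv I f p.proj ((Φ J).1.anchor p.proj (a p.proj)) =
          J.1.bracket (toFunction a) (fun q => f q.proj) p -
            f p.proj * J.1.bracket (toFunction a) (fun _ => 1) p) := by
  have hbracket (J : {J : JacobiStructure (I.prod 𝓘(ℝ, F)) (TotalSpace F A) //
      J.IsStronglyAffine}) (s t) :
      toFunction ((JacobiStructure.equivLieAlgebroid J).1.bracket s t) =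
        J.1.bracket (toFunction s) (toFunction t) :=
    J.2.toFunction_toLieAlgebroid_bracket s t
  refine ⟨JacobiStructure.equivLieAlgebroid, fun J L => ⟨?_, fun h => Subtype.ext ?_⟩,
    fun J a f p => ?_⟩
  · rintro rfl
    exact hbracket J
  · exact LieAlgebroid.eq_of_toFunction_bracket_eq fun s t =>
      (hbracket J s t).trans (h s t).symm
  · have hf : toFunction (f • oneSection I F A) = fun q => f q.proj := funext fun _ => mul_one _
    rw [LieAlgebroid.mvfderiv_anchor, hbracket, hbracket, hf]
    rfl

end Correspondence

end

theorem mainTheorem5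
    {E : Type*} [NormedAddCommGroup E] [NormedSpace ℝ E] [FiniteDimensional ℝ E]
    {M : Type*} [TopologicalSpace M] [T2Space M] [SecondCountableTopology M]
    [ChartedSpace E M] [IsManifold 𝓘(ℝ, E) ∞ M]
    {F : Type*} [NormedAddCommGroup F] [NormedSpace ℝ F] [FiniteDimensional ℝ F]
    {V : M → Type*} [∀ x, AddCommGroup (V x)] [∀ x, Module ℝ (V x)]
    {A : M → Type*} [∀ x, AddTorsor (V x) (A x)] [∀ x, TopologicalSpace (A x)]
    [TopologicalSpace (TotalSpace F A)] [FiberBundle F A] [AffineBundle F A]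
    [SmoothFiberBundle 𝓘(ℝ, E) F A]
    (hrank : 0 < Module.finrank ℝ F) :
    ∃ Φ : {J : JacobiStructure (𝓘(ℝ, E).prod 𝓘(ℝ, F)) (TotalSpace F A) // J.IsStronglyAffine} ≃
        {L : LieAlgebroid 𝓘(ℝ, E) (F →ᴬ[ℝ] ℝ) (AffDual A) //
          L.IsAlmostSpecial (AffDual.oneSection 𝓘(ℝ, E) F A)},
      (∀ J L, Φ J = L ↔ ∀ a b : Cₛ^∞⟮𝓘(ℝ, E); F →ᴬ[ℝ] ℝ, AffDual A⟯,
        AffDual.toFunction (L.1.bracket a b)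
          = J.1.bracket (AffDual.toFunction a) (AffDual.toFunction b)) ∧
      (∀ J, ∀ (a : Cₛ^∞⟮𝓘(ℝ, E); F →ᴬ[ℝ] ℝ, AffDual A⟯) (f : C^∞⟮𝓘(ℝ, E), M; 𝓘(ℝ, ℝ), ℝ⟯)
        (p : TotalSpace F A),
        mvfderiv 𝓘(ℝ, E) f p.proj ((Φ J).1.anchor p.proj (a p.proj))
          = J.1.bracket (AffDual.toFunction a) (fun q => f q.proj) p
            - f p.proj * J.1.bracket (AffDual.toFunction a) (fun _ => 1) p) :=
  haveI : Nontrivial F := Module.finrank_pos_iff.1 hrank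
  mainTheorem5_general
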